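/- Let $A\in\mathbb R^{n\times n}$ and $b,c\in\mathbb R^n$ with $(A,b)$ controllable, let $\Omega\subset\mathbb R^n$ be compact and convex, $\theta\in\Omega$, $x_0\in\mathbb R^n$, and let $r:[0,\infty)\to\mathbb R$ be bounded and continuous. Consider the plant $$\dot x(t)=Ax(t)+b\,(u(t)-\theta^\top x(t)),\quad x(0)=x_0,\qquad y(t)=c^\top x(t).$$ Let $K\in\mathbb R^n$ be such that $A_m=A-bK^\top$ is Hurwitz, put $H_o(s)=(sI-A_m)^{-1}b$, assume $c^\top H_o(0)\neq0$ and set $k_g=1/(c^\top H_o(0))$. Let $C(s)$ be a stable, strictly proper, rational single-input single-output transfer function with $C(0)=1$; $C(s)$ acts on signals with zero initial filter state, i.e. by convolution with its impulse response. Let $Q$ be symmetric positive definite, let $P$ be the solution of $A_m^\top P+PA_m=-Q$, let $\hat\theta_0\in\Omega$, and for $\Gamma_c>0$ let the $\mathcal L_1$ adaptive controller be $$u=-K^\top x+u_2,\qquad u_2(s)=C(s)\big(\bar r(s)+k_g r(s)\big),\qquad \bar r(t)=\hat\theta(t)^\top x(t),$$ $$\dot{\hat x}=A_m\hat x-b\,\hat\theta^\top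 x+b\,u_2,\quad \hat x(0)=x_0,\qquad \dot{\hat\theta}=\Gamma_c\,\mathrm{Proj}\big(\hat\theta,\;x\,(\hat x-x)^\top Pb\big),\quad \hat\theta(0)=\hat\theta_0,$$ where $\mathrm{Proj}(\vartheta,v)$ is the Euclidean projection of $v$ onto the tangent cone of $\Omega$ at $\vartheta\in\Omega$, and $\hat\theta$ is locally absolutely continuous and satisfies its equation for almost every $t\ge0$. Suppose that $$\|\bar G\|_{\mathcal L_1}\,\theta_{\max}<1,\qquad \bar G(s)=H_o(s)(C(s)-1),\qquad \theta_{\max}=\max_{\vartheta\in\Omega}\sum_{i=1}^n|\vartheta_i|,$$ where $\|\bar G\|_{\mathcal L_1}=\max_i\int_0^\infty|\bar g_i(t)|\,dt$ and $\bar g$ is the impulse response of $\bar G$. Let $x_{ref},u_{ref},y_{ref}=c^\top x_{ref}$ be the signals of the reference system, that is, of the same plant with the same initial state in closed loop with the ideal controller $$u_{ref}(s)=C(s)\big(k_g r(s)+\eta(s)\big)-K^\top x_{ref}(s),\qquad \eta(t)=\theta^\top x_{ref}(t).$$ If $x,y,u$ (depending on $\Gamma_c$) are the signals of the adaptive closed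 loop on $[0,\infty)$, then for every $t\ge0$ $$\lim_{\Gamma_c\to\infty}\big(x(t)-x_{ref}(t)\big)=0,\qquad \lim_{\Gamma_c\to\infty}\big(y(t)-y_{ref}(t)\big)=0,\qquad \lim_{\Gamma_c\to\infty}\big(u(t)-u_{ref}(t)\big)=0,$$ and all three limits are uniform in $t\in[0,\infty)$. -/

import Mathlib

open Filter Topology MeasureTheory Set Matrix
open scoped ENNReal

noncomputable section

namespace L1Adaptive

/-! ### Linear time-invariant systems -/

/-- A real square matrix is Hurwitz if all its (complex) eigenvalues have negative real part. -/
def IsHurwitz {n : ℕ} (A : Matrix (Fin n) (Fin n) ℝ) : Prop :=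
  ∀ z ∈ spectrum ℂ (A.map (fun a : ℝ => (a : ℂ))), z.re < 0

/-- Controllability of `(A, b)`: the matrix with columns `b, A b, …, A ^ (n - 1) b` has rank `n`. -/
def IsControllable {n : ℕ} (A : Matrix (Fin n) (Fin n) ℝ) (b : Fin n → ℝ) : Prop :=
  (Matrix.of fun i k : Fin n => ((A ^ (k : ℕ)) *ᵥ b) i).rank = n

/-- The impulse response `e^{At} b` of the single-input system `(s I - A)⁻¹ b`. -/
def stateImpulse {n : ℕ} (A : Matrix (Fin n) (Fin n) ℝ) (b : Fin n → ℝ) (t : ℝ) : Fin n → ℝ :=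
  NormedSpace.exp (t • A) *ᵥ b

/-- The value at a real point `s` of the transfer function `cᵀ (s I - A)⁻¹ b`. -/
def transferAt {n : ℕ} (A : Matrix (Fin n) (Fin n) ℝ) (b c : Fin n → ℝ) (s : ℝ) : ℝ :=
  c ⬝ᵥ ((s • (1 : Matrix (Fin n) (Fin n) ℝ) - A)⁻¹ *ᵥ b)

/-- A strictly proper rational single-input single-output system `C(s) = cᵀ (s I - A)⁻¹ b`,
given by a state-space realization. -/
structure StrictlyProperSystem where
  /-- the order of the realization -/
  order : ℕ
  A : Matrix (Fin order) (Fin order) ℝ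
  b : Fin order → ℝ
  c : Fin order → ℝ

namespace StrictlyProperSystem

/-- The value of the transfer function `C(s)` at a real point `s`. -/
def transfer (C : StrictlyProperSystem) (s : ℝ) : ℝ := transferAt C.A C.b C.c s

/-- The impulse response `cᵀ e^{At} b`, i.e. the inverse Laplace transform of `C(s)`. -/
def impulse (C : StrictlyProperSystem) (t : ℝ) : ℝ := C.c ⬝ᵥ stateImpulse C.A C.b t

/-- The output of `C(s)` (from zero filter state) for the input `v`: the time-domain form of
the Laplace-domain product `C(s) v(s)`. -/
def response (C : StrictlyProperSystem) (v : ℝ → ℝ) (t : ℝ) : ℝ :=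
  ∫ τ in (0 : ℝ)..t, C.impulse (t - τ) * v τ

/-- Stability: the realization has only poles in the open left half plane. Every stable strictly
proper rational transfer function has such a realization. -/
def IsStable (C : StrictlyProperSystem) : Prop := IsHurwitz C.A

end StrictlyProperSystem

/-- The `𝓛₁` gain of a single-input `n`-output system with impulse response `g`:
the maximum over the outputs `i` of `∫₀^∞ |g i t| dt`. -/
def l1Gain {n : ℕ} (g : ℝ → Fin n → ℝ) : ℝ≥0∞ :=
  ⨆ i, ∫⁻ t in Ioi (0 : ℝ), ENNReal.ofReal |g t i|

/-! ### The projection operator -/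

/-- `v = Proj(ϑ, y)`: `v` is the Euclidean projection of `y` onto the tangent cone of `Ω` at `ϑ`
(thus `v = y` when `ϑ` is interior to `Ω`, or when `y` does not point outwards at a boundary
point). -/
def IsProj {n : ℕ} (Ω : Set (Fin n → ℝ)) (ϑ y v : Fin n → ℝ) : Prop :=
  v ∈ posTangentConeAt Ω ϑ ∧
    ∀ w ∈ posTangentConeAt Ω ϑ, (y - v) ⬝ᵥ (y - v) ≤ (y - w) ⬝ᵥ (y - w)

/-! ### The plant and the controller -/

/-- The data of the plant and of the `𝓛₁` adaptive controller, apart from the gain `Γ_c`. -/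
structure Data (n : ℕ) where
  /-- plant matrix -/
  A : Matrix (Fin n) (Fin n) ℝ
  /-- input vector -/
  b : Fin n → ℝ
  /-- output vector -/
  c : Fin n → ℝ
  /-- unknown constant parameter -/
  θ : Fin n → ℝ
  /-- the known set of admissible parameters -/
  Ω : Set (Fin n → ℝ)
  /-- static feedback gain -/
  K : Fin n → ℝ
  /-- the low-pass filter `C(s)` -/
  C : StrictlyProperSystem
  /-- the matrix `P` of the adaptive law -/
  P : Matrix (Fin n) (Fin n) ℝ
  /-- reference signal -/
  r : ℝ → ℝ
  /-- initial state -/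
  x₀ : Fin n → ℝ
  /-- initial parameter estimate -/
  θhat₀ : Fin n → ℝ

namespace Data

variable {n : ℕ} (S : Data n)

/-- `A_m = A - b Kᵀ`. -/
def Am : Matrix (Fin n) (Fin n) ℝ := S.A - vecMulVec S.b S.K

/-- `k_g = 1 / (cᵀ H_o(0))`, where `H_o(s) = (s I - A_m)⁻¹ b`. -/
def kg : ℝ := 1 / transferAt S.Am S.b S.c 0

/-- The impulse response of `Ḡ(s) = H_o(s) (C(s) - 1)`: the convolution of the impulse responses
of `H_o` and `C`, minus the impulse response of `H_o`. -/
def gBar (t : ℝ) : Fin n → ℝ := fun i =>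
  (∫ τ in (0 : ℝ)..t, stateImpulse S.Am S.b (t - τ) i * S.C.impulse τ)
    - stateImpulse S.Am S.b t i

/-- `θ_max`, the maximum of `∑ |ϑ i|` over `ϑ ∈ Ω`. -/
def thetaMax : ℝ := sSup ((fun ϑ : Fin n → ℝ => ∑ i, |ϑ i|) '' S.Ω)

/-- The `𝓛₁`-gain requirement `‖Ḡ‖ θ_max < 1`. -/
def GainRequirement : Prop := l1Gain S.gBar * ENNReal.ofReal S.thetaMax < 1

/-- The plant `ẋ = A x + b (u - θᵀ x)`, `x(0) = x₀`, on `[0, ∞)`. -/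
def IsPlantSolution (x : ℝ → Fin n → ℝ) (u : ℝ → ℝ) : Prop :=
  x 0 = S.x₀ ∧ ∀ t, 0 ≤ t →
    HasDerivWithinAt x (S.A *ᵥ x t + (u t - S.θ ⬝ᵥ x t) • S.b) (Ici 0) t

/-- The plant in closed loop with the `𝓛₁` adaptive controller with gain `Γ = Γ_c I`; `xhat` is the
predictor state, `θhat` the parameter estimate and `u` the control signal. The estimate is a
locally absolutely continuous (Carathéodory) solution of its differential equation, since `Proj`
is discontinuous at the boundary of `Ω`. -/
structure IsAdaptiveLoop (Γc : ℝ) (x xhat θhat : ℝ → Fin n → ℝ) (u : ℝ → ℝ) : Prop where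
  plant : S.IsPlantSolution x u
  /-- `u = - Kᵀ x + u₂`, `u₂(s) = C(s) (r̄(s) + k_g r(s))`, `r̄ = θhatᵀ x` -/
  control : ∀ t, 0 ≤ t →
    u t = - (S.K ⬝ᵥ x t) + S.C.response (fun τ => θhat τ ⬝ᵥ x τ + S.kg * S.r τ) t
  predictor_init : xhat 0 = S.x₀
  /-- `d xhat / dt = A_m xhat - b θhatᵀ x + b u₂` -/
  predictor : ∀ t, 0 ≤ t → HasDerivWithinAt xhat
    (S.Am *ᵥ xhat t - (θhat t ⬝ᵥ x t) • S.b
      + (S.C.response (fun τ => θhat τ ⬝ᵥ x τ + S.kg * S.r τ) t) • S.b) (Ici 0) t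
  estimate_init : θhat 0 = S.θhat₀
  estimate_ac : ∀ T, 0 < T → AbsolutelyContinuousOnInterval θhat 0 T
  /-- `d θhat / dt = Γ_c Proj(θhat, x (xhat - x)ᵀ P b)` -/
  adaptation : ∀ᵐ t ∂(volume.restrict (Ici (0 : ℝ))), ∃ v : Fin n → ℝ,
    IsProj S.Ω (θhat t) (((xhat t - x t) ⬝ᵥ (S.P *ᵥ S.b)) • x t) v ∧
      HasDerivAt θhat (Γc • v) t

/-- The reference system: the plant in closed loop with the ideal controller
`u_ref(s) = C(s) (k_g r(s) + η(s)) - Kᵀ x_ref(s)`, `η = θᵀ x_ref`. -/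
structure IsReferenceLoop (xref : ℝ → Fin n → ℝ) (uref : ℝ → ℝ) : Prop where
  plant : S.IsPlantSolution xref uref
  control : ∀ t, 0 ≤ t →
    uref t = S.C.response (fun τ => S.kg * S.r τ + S.θ ⬝ᵥ xref τ) t - S.K ⬝ᵥ xref t

end Data

end L1Adaptive

end

/-! Three signals are estimated in turn: the prediction error `z = xhat - x`, the filtered mismatch
`C η` with `η = (θhat - θ)ᵀ x`, and the tracking error `e = x - xref`. Each is `O(Γc^(-1/2))`
uniformly in time.

Here `z' = A_m z - η b` with `z(0) = 0`. The quantity `Γc zᵀ P z + |θhat - θ|²` does not increase,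
because the projection onto the tangent cone of a convex set only helps when compared with the point
`θ` of `Ω`. As `P` is positive definite, `‖z‖² ≤ D / (μ Γc)` with `D = |θhat₀ - θ|²`
(`lyapunov_le`).

Smallness of `z` does not make `η` small, since `η` involves `z'`. Only `C η` enters the loop, and
`C` is strictly proper: solving the error equation for `η` along `b` and integrating by parts moves
the derivative onto the impulse response of `C`, so `|C η|` is at most a constant times `sup ‖z‖`
(`exists_abs_response_le_of_state`). No bound on `x` is needed.

Finally `e = Ḡ * (θᵀ e) + H_o * (C η)`, and the gain condition makes this a small-gain loop, so `e`
is bounded by a multiple of `sup |C η|` (`exists_norm_error_le`). The input follows from `u - uref =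
-Kᵀ e + C(θᵀ e) + C η`. -/

namespace L1Adaptive

/-! ### Exponential decay of `exp (t A)` for Hurwitz `A`. -/

section MatrixExp

variable {m : Type*} [Fintype m] [DecidableEq m]

open scoped Matrix.Norms.Operator in
theorem hasDerivAt_exp_smul_matrix (A : Matrix m m ℝ) (t : ℝ) :
    HasDerivAt (fun s : ℝ => NormedSpace.exp (s • A)) (A * NormedSpace.exp (t • A)) t :=
  hasDerivAt_exp_smul_const' A t

open scoped Matrix.Norms.Operator in
theorem hasSum_exp_matrix (A : Matrix m m ℂ) :
    HasSum (fun k : ℕ => ((k.factorial : ℂ)⁻¹) • A ^ k) (NormedSpace.exp A) :=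
  NormedSpace.exp_series_hasSum_exp' (𝕂 := ℂ) A

open scoped Matrix.Norms.Operator in
theorem exp_map_ofReal (A : Matrix m m ℝ) :
    (NormedSpace.exp A).map (fun a : ℝ => (a : ℂ)) =
      NormedSpace.exp (A.map (fun a : ℝ => (a : ℂ))) := by
  have := NormedSpace.map_exp (Complex.ofRealHom.mapMatrix (m := m))
    (Continuous.matrix_map continuous_id Complex.continuous_ofReal) A
  exact this

theorem exp_scalar_matrix (z : ℂ) :
    NormedSpace.exp (z • (1 : Matrix m m ℂ)) = Complex.exp z • (1 : Matrix m m ℂ) := by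
  have := Matrix.exp_diagonal (m := m) (fun _ => z)
  rw [Matrix.smul_one_eq_diagonal, this, Matrix.smul_one_eq_diagonal]
  congr 1
  ext i
  rw [Complex.exp_eq_exp_ℂ, Pi.coe_exp]

/-- Since `B = z + N` with commuting summands, the scalar part factors out; the series of `exp (t
N)` stops on `v` because `N ^ k` kills it. -/
theorem exp_smul_mulVec_of_pow_mulVec_eq_zero (B : Matrix m m ℂ) (z : ℂ) {k : ℕ} {v : m → ℂ}
    (hv : ((B - z • 1) ^ k) *ᵥ v = 0) (t : ℝ) :
    NormedSpace.exp ((t : ℂ) • B) *ᵥ v =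
      Complex.exp (t * z) • ∑ j ∈ Finset.range k,
        ((j.factorial : ℂ)⁻¹ * (t : ℂ) ^ j) • (((B - z • 1) ^ j) *ᵥ v) := by
  set N : Matrix m m ℂ := B - z • 1 with hN
  have hB : (t : ℂ) • B = ((t : ℂ) * z) • (1 : Matrix m m ℂ) + (t : ℂ) • N := by
    rw [hN, smul_sub, smul_smul]; abel
  have hcomm : Commute (((t : ℂ) * z) • (1 : Matrix m m ℂ)) ((t : ℂ) • N) :=
    (Commute.one_left _).smul_left _
  rw [hB, Matrix.exp_add_of_commute _ _ hcomm, exp_scalar_matrix, smul_mul_assoc, one_mul,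
    Matrix.smul_mulVec]
  congr 1
  have hcont : Continuous fun M : Matrix m m ℂ => M *ᵥ v :=
    Continuous.matrix_mulVec continuous_id continuous_const
  let L : Matrix m m ℂ →+ (m → ℂ) :=
    { toFun := fun M => M *ᵥ v, map_zero' := Matrix.zero_mulVec v,
      map_add' := fun M M' => Matrix.add_mulVec M M' v }
  have hs := (hasSum_exp_matrix ((t : ℂ) • N)).map L hcont
  have hz : ∀ j ∉ Finset.range k, L (((j.factorial : ℂ)⁻¹) • ((t : ℂ) • N) ^ j) = 0 := by
    intro j hj
    obtain ⟨l, rfl⟩ := Nat.exists_eq_add_of_le' (not_lt.mp (Finset.mem_range.not.mp hj))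
    change (_ • _) *ᵥ v = 0
    rw [smul_pow, pow_add N, Matrix.smul_mulVec, Matrix.smul_mulVec, ← Matrix.mulVec_mulVec, hv,
      Matrix.mulVec_zero, smul_zero, smul_zero]
  have hsum := hasSum_sum_of_ne_finset_zero (L := .unconditional ℕ) hz
  refine (hs.unique hsum).trans (Finset.sum_congr rfl fun j _ => ?_)
  change (_ • _) *ᵥ v = _
  rw [smul_pow, Matrix.smul_mulVec, Matrix.smul_mulVec, smul_smul]

/-- The gap between `z.re` and `-α` absorbs the polynomial factor created by the nilpotent part. -/
theorem exp_smul_mulVec_isBigO_of_pow_mulVec_eq_zero (B : Matrix m m ℂ) {z : ℂ} {α : ℝ}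
    (hz : z.re < -α) {k : ℕ} {v : m → ℂ} (hv : ((B - z • 1) ^ k) *ᵥ v = 0) :
    (fun t : ℝ => NormedSpace.exp ((t : ℂ) • B) *ᵥ v) =O[atTop] fun t => Real.exp (-α * t) := by
  simp_rw [exp_smul_mulVec_of_pow_mulVec_eq_zero B z hv, Finset.smul_sum, smul_smul]
  refine Asymptotics.IsBigO.fun_sum fun j _ => ?_
  have h1 : (fun t : ℝ => t ^ j) =O[atTop] fun t => Real.exp ((-α - z.re) * t) :=
    (isLittleO_pow_exp_pos_mul_atTop j (by linarith)).isBigO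
  have h2 : (fun t : ℝ => Real.exp (z.re * t) * t ^ j) =O[atTop]
      fun t => Real.exp (-α * t) := by
    refine ((Asymptotics.isBigO_refl (fun t : ℝ => Real.exp (z.re * t)) _).mul h1).congr_right ?_
    intro t
    rw [← Real.exp_add]; ring_nf
  refine (Asymptotics.IsBigO.trans ?_ h2)
  refine Asymptotics.IsBigO.of_bound (‖(j.factorial : ℂ)⁻¹‖ * ‖((B - z • 1) ^ j) *ᵥ v‖)
    (Eventually.of_forall fun t => le_of_eq ?_)
  rw [norm_smul, norm_mul, norm_mul, Complex.norm_exp, norm_mul, Real.norm_eq_abs, Real.abs_exp,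
    norm_pow, norm_pow, Complex.norm_real, Complex.re_ofReal_mul, mul_comm t]
  ring

/-- If all eigenvalues of `B` have real part less than `-α`, then `exp (t B)` decays at least as
fast as `exp (-α t)`. -/
theorem exp_smul_mulVec_isBigO (B : Matrix m m ℂ) {α : ℝ}
    (hB : ∀ z ∈ spectrum ℂ B, z.re < -α) (v : m → ℂ) :
    (fun t : ℝ => NormedSpace.exp ((t : ℂ) • B) *ᵥ v) =O[atTop] fun t => Real.exp (-α * t) := by
  -- Over `ℂ` the generalized eigenspaces span, so it suffices to treat a generalized eigenvector
  -- and sums.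
  have hv : v ∈ ⨆ z : ℂ, Module.End.maxGenEigenspace (Matrix.toLin' B) z := by
    rw [Module.End.iSup_maxGenEigenspace_eq_top]; trivial
  induction hv using Submodule.iSup_induction' with
  | mem z w hw =>
    obtain ⟨k, hk⟩ := Module.End.mem_maxGenEigenspace _ _ _ |>.mp hw
    have hk' : ((B - z • 1) ^ k) *ᵥ w = 0 := by
      rw [← Matrix.toLin'_apply, Matrix.toLin'_pow, map_sub, map_smul, Matrix.toLin'_one]
      exact hk
    by_cases hzs : z ∈ spectrum ℂ B
    · exact exp_smul_mulVec_isBigO_of_pow_mulVec_eq_zero B (hB z hzs) hk'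
    · have hu : IsUnit ((B - z • 1) ^ k) := by
        have := (spectrum.notMem_iff.mp hzs).neg
        rw [neg_sub, Algebra.algebraMap_eq_smul_one] at this
        exact this.pow k
      obtain rfl : w = 0 := Matrix.mulVec_injective_of_isUnit hu (by rw [hk', Matrix.mulVec_zero])
      simp_rw [Matrix.mulVec_zero]
      exact Asymptotics.isBigO_zero _ _
  | zero =>
    simp_rw [Matrix.mulVec_zero]
    exact Asymptotics.isBigO_zero _ _
  | add x y _ _ hx hy => simpa [Matrix.mulVec_add] using hx.add hy

theorem commute_exp_smul_matrix (A : Matrix m m ℝ) (t : ℝ) :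
    A * NormedSpace.exp (t • A) = NormedSpace.exp (t • A) * A :=
  (((Commute.refl A).smul_right t).exp_right).eq

open scoped Matrix.Norms.Operator in
theorem hasDerivAt_exp_smul_mulVec (A : Matrix m m ℝ) (v : m → ℝ) (t : ℝ) :
    HasDerivAt (fun s : ℝ => NormedSpace.exp (s • A) *ᵥ v)
      (A *ᵥ (NormedSpace.exp (t • A) *ᵥ v)) t := by
  have h := hasDerivAt_exp_smul_matrix A t
  let L : Matrix m m ℝ →L[ℝ] (m → ℝ) :=
    LinearMap.toContinuousLinearMap ((Matrix.mulVecBilin ℝ ℝ).flip v)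
  have h2 := L.hasFDerivAt.comp_hasDerivAt t h
  rw [Matrix.mulVec_mulVec]
  exact h2

theorem norm_ofReal_comp {m : ℕ} (v : Fin m → ℝ) : ‖fun i => (v i : ℂ)‖ = ‖v‖ := by
  simp [Pi.norm_def]

end MatrixExp

theorem continuous_exp_smul_mulVec {m : ℕ} (A : Matrix (Fin m) (Fin m) ℝ) (v : Fin m → ℝ) :
    Continuous fun s : ℝ => NormedSpace.exp (s • A) *ᵥ v :=
  continuous_iff_continuousAt.2 fun t => (hasDerivAt_exp_smul_mulVec A v t).continuousAt

/-- The spectrum is finite, hence bounded away from the imaginary axis, which gives one rate `α` for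
all vectors; real vectors are then embedded in the complex statement. -/
theorem IsHurwitz.exists_exp_isBigO {m : ℕ} {A : Matrix (Fin m) (Fin m) ℝ} (hA : IsHurwitz A) :
    ∃ α : ℝ, 0 < α ∧ ∀ v : Fin m → ℝ,
      (fun t : ℝ => NormedSpace.exp (t • A) *ᵥ v) =O[atTop] fun t => Real.exp (-α * t) := by
  set B := A.map (fun a : ℝ => (a : ℂ)) with hBdef
  have h1 : ∀ᶠ α in 𝓝[>] (0 : ℝ), ∀ z ∈ spectrum ℂ B, z.re < -α := by
    rw [eventually_all_finite (Matrix.finite_spectrum B)]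
    intro z hz
    have hz0 := hA z hz
    filter_upwards [nhdsWithin_le_nhds (Iio_mem_nhds (show (0 : ℝ) < -z.re by linarith))] with α hα
    have : α < -z.re := hα
    linarith
  obtain ⟨α, hα, hα0⟩ := (h1.and self_mem_nhdsWithin).exists
  refine ⟨α, hα0, fun v => ?_⟩
  have h2 := exp_smul_mulVec_isBigO B hα (fun i => (v i : ℂ))
  refine Asymptotics.IsBigO.trans (Asymptotics.IsBigO.of_bound 1 ?_) h2
  refine Eventually.of_forall fun t => ?_
  rw [one_mul, ← norm_ofReal_comp]
  refine le_of_eq (congrArg _ ?_)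
  have h3 : (t : ℂ) • B = (t • A).map (fun a : ℝ => (a : ℂ)) := by
    ext i j; simp [hBdef]
  rw [h3, ← exp_map_ofReal]
  ext i
  simp [Matrix.mulVec, dotProduct]

/-- The matrix exponential of a Hurwitz matrix decays exponentially. -/
theorem IsHurwitz.exists_norm_exp_le {m : ℕ} {A : Matrix (Fin m) (Fin m) ℝ} (hA : IsHurwitz A)
    (v : Fin m → ℝ) : ∃ M α : ℝ, 0 ≤ M ∧ 0 < α ∧ ∀ t, 0 ≤ t →
      ‖NormedSpace.exp (t • A) *ᵥ v‖ ≤ M * Real.exp (-α * t) := by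
  obtain ⟨α, hα, h⟩ := hA.exists_exp_isBigO
  obtain ⟨c, hc⟩ := (h v).bound
  obtain ⟨T, hT⟩ := eventually_atTop.mp hc
  obtain ⟨D, hD⟩ := (isCompact_Icc (a := (0 : ℝ)) (b := T)).exists_bound_of_continuousOn
    (f := fun t => Real.exp (α * t) • (NormedSpace.exp (t • A) *ᵥ v))
    ((by fun_prop : Continuous fun t : ℝ => Real.exp (α * t)).smul
      (continuous_exp_smul_mulVec A v)).continuousOn
  -- `c` serves the tail `t ≥ T`, `D` the compact interval `[0, T]`, and `0` ensures a nonnegative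
  -- constant.
  refine ⟨max (max c D) 0, α, le_max_right _ _, hα, fun t ht => ?_⟩
  have hpos := Real.exp_pos (-α * t)
  rcases le_total T t with hTt | hTt
  · refine (hT t hTt).trans ?_
    rw [Real.norm_eq_abs, Real.abs_exp]
    gcongr
    exact (le_max_left _ _).trans (le_max_left _ _)
  · have := hD t ⟨ht, hTt⟩
    rw [norm_smul, Real.norm_eq_abs, Real.abs_exp] at this
    have h3 : ‖NormedSpace.exp (t • A) *ᵥ v‖ ≤ D * Real.exp (-α * t) := by
      calc ‖NormedSpace.exp (t • A) *ᵥ v‖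
          = (Real.exp (α * t) * ‖NormedSpace.exp (t • A) *ᵥ v‖) * Real.exp (-α * t) := by
            rw [mul_right_comm, ← Real.exp_add]; simp
        _ ≤ _ := by gcongr
    refine h3.trans ?_
    gcongr
    exact (le_max_right _ _).trans (le_max_left _ _)

/-! ### Causal convolutions on `[0, ∞)`. -/

section Convolution

/-- Extending a function from `[0, ∞)` by its value at `0` makes it continuous. -/
theorem continuous_comp_max {E : Type*} [TopologicalSpace E] {w : ℝ → E}
    (hw : ContinuousOn w (Ici 0)) : Continuous fun t => w (max 0 t) :=
  hw.comp_continuous (by fun_prop) fun t => le_max_left 0 t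

theorem integral_comp_max (k w : ℝ → ℝ) {t : ℝ} (ht : 0 ≤ t) :
    ∫ τ in (0 : ℝ)..t, k (t - τ) * w (max 0 τ) = ∫ τ in (0 : ℝ)..t, k (t - τ) * w τ := by
  refine intervalIntegral.integral_congr fun τ hτ => ?_
  rw [uIcc_of_le ht] at hτ
  simp only [max_eq_right hτ.1]

theorem continuousOn_causal_convolution {k w : ℝ → ℝ} (hk : Continuous k)
    (hw : ContinuousOn w (Ici 0)) :
    ContinuousOn (fun t => ∫ τ in (0 : ℝ)..t, k (t - τ) * w τ) (Ici 0) := by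
  have hw' := continuous_comp_max hw
  have h : Continuous fun t => ∫ τ in (0 : ℝ)..t, k (t - τ) * w (max 0 τ) := by
    refine intervalIntegral.continuous_parametric_intervalIntegral_of_continuous
      (f := fun t τ => k (t - τ) * w (max 0 τ)) ?_ continuous_id
    exact (hk.comp (continuous_fst.sub continuous_snd)).mul (hw'.comp continuous_snd)
  exact h.continuousOn.congr fun t ht => (integral_comp_max k w ht).symm

theorem intervalIntegrable_causal {k w : ℝ → ℝ} (hk : Continuous k)
    (hw : ContinuousOn w (Ici 0)) {t : ℝ} (ht : 0 ≤ t) :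
    IntervalIntegrable (fun τ => k (t - τ) * w τ) volume 0 t := by
  refine ContinuousOn.intervalIntegrable ?_
  rw [uIcc_of_le ht]
  exact (by fun_prop : Continuous fun τ => k (t - τ)).continuousOn.mul
    (hw.mono Icc_subset_Ici_self)

/-- Young's `L¹`–`L^∞` inequality truncated to `[0, t]`; causality means only the past of `w`
matters. -/
theorem abs_causal_convolution_le {f w : ℝ → ℝ} (hf : Continuous f) {t W : ℝ}
    (ht : 0 ≤ t) (hw : ∀ τ, 0 ≤ τ → τ ≤ t → |w τ| ≤ W) :
    |∫ τ in (0 : ℝ)..t, f (t - τ) * w τ| ≤ (∫ τ in (0 : ℝ)..t, |f τ|) * W := by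
  have h1 : (∫ τ in (0 : ℝ)..t, |f τ|) * W = ∫ τ in (0 : ℝ)..t, |f (t - τ)| * W := by
    rw [intervalIntegral.integral_mul_const,
      intervalIntegral.integral_comp_sub_left (fun τ => |f τ|) t]
    simp
  rw [h1, ← Real.norm_eq_abs]
  refine intervalIntegral.norm_integral_le_of_norm_le ht (Eventually.of_forall fun τ hτ => ?_) ?_
  · rw [Real.norm_eq_abs, abs_mul]
    exact mul_le_mul_of_nonneg_left (hw τ hτ.1.le hτ.2) (abs_nonneg _)
  · exact (by fun_prop : Continuous fun τ => |f (t - τ)| * W).intervalIntegrable _ _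

/-- Fubini on the square, after extending `F` by zero above the diagonal. -/
theorem integral_integral_swap_triangle {F : ℝ → ℝ → ℝ}
    (hF : Continuous (Function.uncurry F)) {t : ℝ} (ht : 0 ≤ t) :
    ∫ τ in (0 : ℝ)..t, ∫ s in (0 : ℝ)..τ, F τ s =
      ∫ s in (0 : ℝ)..t, ∫ τ in s..t, F τ s := by
  have hcomp : IsCompact (Icc 0 t ×ˢ Icc 0 t : Set (ℝ × ℝ)) := isCompact_Icc.prod isCompact_Icc
  have hT : MeasurableSet {p : ℝ × ℝ | p.2 ≤ p.1} := measurableSet_le measurable_snd measurable_fst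
  have hint : Integrable (Function.uncurry fun τ s => if s ≤ τ then F τ s else 0)
      ((volume.restrict (Ioc 0 t)).prod (volume.restrict (Ioc 0 t))) := by
    have h0 : IntegrableOn (Function.uncurry F) (Ioc 0 t ×ˢ Ioc 0 t) (volume.prod volume) :=
      (hF.continuousOn.integrableOn_compact hcomp).mono_set
        (prod_mono Ioc_subset_Icc_self Ioc_subset_Icc_self)
    rw [Measure.prod_restrict]
    refine (h0.indicator hT).congr (Eventually.of_forall fun p => ?_)
    by_cases h : p.2 ≤ p.1 <;> simp [indicator, Function.uncurry, h]
  have hswap := integral_integral_swap hint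
  rw [intervalIntegral.integral_of_le ht, intervalIntegral.integral_of_le ht]
  have hl : ∀ τ ∈ Ioc 0 t, ∫ s in (0 : ℝ)..τ, F τ s =
      ∫ s in Ioc 0 t, if s ≤ τ then F τ s else 0 := by
    intro τ hτ
    rw [intervalIntegral.integral_of_le hτ.1.le]
    have : (fun s => if s ≤ τ then F τ s else 0) = (Iic τ).indicator (F τ) := by
      ext s; simp [indicator]
    rw [this, setIntegral_indicator measurableSet_Iic, Ioc_inter_Iic, min_eq_right hτ.2]
  have hr : ∀ s ∈ Ioc 0 t, ∫ τ in s..t, F τ s =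
      ∫ τ in Ioc 0 t, if s ≤ τ then F τ s else 0 := by
    intro s hs
    rw [intervalIntegral.integral_of_le hs.2]
    have : (fun τ => if s ≤ τ then F τ s else 0) = (Ici s).indicator fun τ => F τ s := by
      ext τ; simp [indicator]
    rw [this, setIntegral_indicator measurableSet_Ici, ← integral_Icc_eq_integral_Ioc]
    congr 2
    ext τ
    simp only [mem_Icc, mem_inter_iff, mem_Ioc, mem_Ici]
    constructor
    · rintro ⟨h1, h2⟩; exact ⟨⟨hs.1.trans_le h1, h2⟩, h1⟩
    · rintro ⟨⟨_, h2⟩, h1⟩; exact ⟨h1, h2⟩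
  rw [setIntegral_congr_fun measurableSet_Ioc hl, setIntegral_congr_fun measurableSet_Ioc hr]
  exact hswap

theorem causal_convolution_assoc {h k w : ℝ → ℝ} (hh : Continuous h) (hk : Continuous k)
    (hw : ContinuousOn w (Ici 0)) {t : ℝ} (ht : 0 ≤ t) :
    ∫ τ in (0 : ℝ)..t, h (t - τ) * ∫ s in (0 : ℝ)..τ, k (τ - s) * w s =
      ∫ s in (0 : ℝ)..t, (∫ σ in (0 : ℝ)..(t - s), h (t - s - σ) * k σ) * w s := by
  have hw' := continuous_comp_max hw
  have h1 : ∫ τ in (0 : ℝ)..t, h (t - τ) * ∫ s in (0 : ℝ)..τ, k (τ - s) * w s =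
      ∫ τ in (0 : ℝ)..t, ∫ s in (0 : ℝ)..τ, h (t - τ) * (k (τ - s) * w (max 0 s)) := by
    refine intervalIntegral.integral_congr fun τ hτ => ?_
    rw [uIcc_of_le ht] at hτ
    rw [intervalIntegral.integral_const_mul, integral_comp_max k w hτ.1]
  have hF : Continuous (Function.uncurry fun τ s => h (t - τ) * (k (τ - s) * w (max 0 s))) :=
    (hh.comp (continuous_const.sub continuous_fst)).mul
      ((hk.comp (continuous_fst.sub continuous_snd)).mul (hw'.comp continuous_snd))
  rw [h1, integral_integral_swap_triangle hF ht]
  refine intervalIntegral.integral_congr fun s hs => ?_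
  rw [uIcc_of_le ht] at hs
  simp only [max_eq_right hs.1]
  have h2 := intervalIntegral.integral_comp_add_right (a := 0) (b := t - s)
    (fun τ => h (t - τ) * (k (τ - s) * w s)) s
  rw [zero_add, sub_add_cancel] at h2
  rw [← h2, ← intervalIntegral.integral_mul_const]
  refine intervalIntegral.integral_congr fun σ _ => ?_
  simp only [add_sub_cancel_right]
  rw [show t - (σ + s) = t - s - σ by ring]
  ring

end Convolution

/-! ### Impulse responses and variation of constants. -/

section LinearSystem

theorem abs_dotProduct_le {n : ℕ} (d x : Fin n → ℝ) : |d ⬝ᵥ x| ≤ (∑ i, |d i|) * ‖x‖ := by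
  rw [dotProduct, Finset.sum_mul]
  refine (Finset.abs_sum_le_sum_abs _ _).trans (Finset.sum_le_sum fun i _ => ?_)
  rw [abs_mul]
  gcongr
  exact norm_le_pi_norm x i

theorem continuous_stateImpulse {n : ℕ} (A : Matrix (Fin n) (Fin n) ℝ) (b : Fin n → ℝ) :
    Continuous (stateImpulse A b) := continuous_exp_smul_mulVec A b

theorem StrictlyProperSystem.continuous_impulse (C : StrictlyProperSystem) :
    Continuous C.impulse :=
  continuous_const.dotProduct (continuous_stateImpulse C.A C.b)

/-- The impulse responses of a Hurwitz system have finite `L¹` norm. -/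
theorem IsHurwitz.exists_integral_abs_le {n : ℕ} {A : Matrix (Fin n) (Fin n) ℝ}
    (hA : IsHurwitz A) (d v : Fin n → ℝ) :
    ∃ c : ℝ, 0 ≤ c ∧ ∀ t, 0 ≤ t → ∫ τ in (0 : ℝ)..t, |d ⬝ᵥ stateImpulse A v τ| ≤ c := by
  obtain ⟨M, α, hM, hα, h⟩ := hA.exists_norm_exp_le v
  set D := ∑ i, |d i| with hD
  have hD0 : 0 ≤ D := Finset.sum_nonneg fun i _ => abs_nonneg _
  refine ⟨D * M / α, by positivity, fun t ht => ?_⟩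
  have hder : ∀ τ ∈ uIcc 0 t, HasDerivAt (fun τ => -(D * M / α) * Real.exp (-α * τ))
      (D * M * Real.exp (-α * τ)) τ := by
    intro τ _
    have := (((hasDerivAt_id τ).const_mul (-α)).exp).const_mul (-(D * M / α))
    refine this.congr_deriv ?_
    simp only [id_eq]
    field_simp
  have hint := intervalIntegral.integral_eq_sub_of_hasDerivAt hder
    ((by fun_prop : Continuous fun τ => D * M * Real.exp (-α * τ)).intervalIntegrable _ _)
  have hle : ∫ τ in (0 : ℝ)..t, |d ⬝ᵥ stateImpulse A v τ| ≤
      ∫ τ in (0 : ℝ)..t, D * M * Real.exp (-α * τ) := by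
    refine intervalIntegral.integral_mono_on ht ?_ ?_ fun τ hτ => ?_
    · exact (continuous_const.dotProduct (continuous_stateImpulse A v)).abs.intervalIntegrable _ _
    · exact (by fun_prop : Continuous fun τ => D * M * Real.exp (-α * τ)).intervalIntegrable _ _
    · refine (abs_dotProduct_le _ _).trans ?_
      rw [mul_assoc]
      exact mul_le_mul_of_nonneg_left (h τ hτ.1) hD0
  refine hle.trans ?_
  rw [hint]
  have : 0 ≤ D * M / α * Real.exp (-α * t) := by positivity
  simp only [mul_zero, Real.exp_zero, mul_one]
  linarith

theorem hasDerivAt_dotProduct_stateImpulse {n : ℕ} (A : Matrix (Fin n) (Fin n) ℝ)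
    (d v : Fin n → ℝ) (t : ℝ) :
    HasDerivAt (fun s => d ⬝ᵥ stateImpulse A v s) (d ⬝ᵥ stateImpulse A (A *ᵥ v) t) t := by
  have h := hasDerivAt_exp_smul_mulVec A v t
  rw [Matrix.mulVec_mulVec, commute_exp_smul_matrix, ← Matrix.mulVec_mulVec] at h
  exact HasDerivAt.fun_sum fun i _ => ((hasDerivAt_pi.mp h) i).const_mul (d i)

theorem HasDerivWithinAt.continuousOn_Ici {E : Type*} [NormedAddCommGroup E] [NormedSpace ℝ E]
    {f f' : ℝ → E} (h : ∀ t, 0 ≤ t → HasDerivWithinAt f (f' t) (Ici 0) t) :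
    ContinuousOn f (Ici 0) := fun t ht => (h t ht).continuousWithinAt

theorem integral_deriv_eq_sub_of_Ici {f f' : ℝ → ℝ}
    (h : ∀ t, 0 ≤ t → HasDerivWithinAt f (f' t) (Ici 0) t) {t : ℝ} (ht : 0 ≤ t)
    (hf' : IntervalIntegrable f' volume 0 t) : ∫ τ in (0 : ℝ)..t, f' τ = f t - f 0 :=
  intervalIntegral.integral_eq_sub_of_hasDerivAt_of_le ht
    ((HasDerivWithinAt.continuousOn_Ici h).mono Icc_subset_Ici_self)
    (fun τ hτ => (h τ hτ.1.le).hasDerivAt (Ici_mem_nhds hτ.1)) hf'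

/-- Variation of constants with zero initial state. -/
theorem variation_of_constants {n : ℕ} {A : Matrix (Fin n) (Fin n) ℝ} {b : Fin n → ℝ}
    {e : ℝ → Fin n → ℝ} {v : ℝ → ℝ} (hv : ContinuousOn v (Ici 0)) (he0 : e 0 = 0)
    (he : ∀ t, 0 ≤ t → HasDerivWithinAt e (A *ᵥ e t + v t • b) (Ici 0) t) {t : ℝ} (ht : 0 ≤ t)
    (i : Fin n) : e t i = ∫ τ in (0 : ℝ)..t, stateImpulse A b (t - τ) i * v τ := by
  have hent : ∀ j, ∀ τ, HasDerivAt (fun s => NormedSpace.exp ((t - s) • A) i j)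
      (-(NormedSpace.exp ((t - τ) • A) * A) i j) τ := by
    intro j τ
    have h1 := (hasDerivAt_pi.mp (hasDerivAt_exp_smul_mulVec A (Pi.single j 1) (t - τ))) i
    rw [Matrix.mulVec_mulVec, commute_exp_smul_matrix] at h1
    simp only [Matrix.mulVec_single_one, Matrix.col_apply] at h1
    exact h1.comp_const_sub t τ
  -- Integrating factor: in the derivative of `exp ((t - s) A) e(s)` the two terms with `A` cancel.
  have hder : ∀ τ, 0 ≤ τ → HasDerivWithinAt (fun s => (NormedSpace.exp ((t - s) • A) *ᵥ e s) i)
      (stateImpulse A b (t - τ) i * v τ) (Ici 0) τ := by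
    intro τ hτ
    have h2 := HasDerivWithinAt.fun_sum (u := Finset.univ) fun j _ =>
      ((hent j τ).hasDerivWithinAt (s := Ici 0)).mul ((hasDerivWithinAt_pi.mp (he τ hτ)) j)
    refine h2.congr_deriv ?_
    rw [Finset.sum_add_distrib]
    have h3 : ∑ j, -(NormedSpace.exp ((t - τ) • A) * A) i j * e τ j =
        -(NormedSpace.exp ((t - τ) • A) *ᵥ (A *ᵥ e τ)) i := by
      rw [Matrix.mulVec_mulVec]
      simp [Matrix.mulVec, dotProduct]
    have h4 : ∑ j, NormedSpace.exp ((t - τ) • A) i j * (A *ᵥ e τ + v τ • b) j =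
        (NormedSpace.exp ((t - τ) • A) *ᵥ (A *ᵥ e τ + v τ • b)) i := rfl
    rw [h3, h4, Matrix.mulVec_add, Matrix.mulVec_smul]
    simp only [stateImpulse, Pi.add_apply, Pi.smul_apply, smul_eq_mul]
    ring
  have hk : Continuous fun s => stateImpulse A b s i :=
    (continuous_apply i).comp (continuous_stateImpulse A b)
  have := integral_deriv_eq_sub_of_Ici hder ht (intervalIntegrable_causal hk hv ht)
  rw [this, he0]
  simp

end LinearSystem

/-! ### Filtering a signal that is seen only through the state it drives. -/

section Filter

theorem HasDerivWithinAt.const_dotProduct {n : ℕ} (d : Fin n → ℝ) {f : ℝ → Fin n → ℝ}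
    {f' : Fin n → ℝ} {s : Set ℝ} {t : ℝ} (h : HasDerivWithinAt f f' s t) :
    HasDerivWithinAt (fun τ => d ⬝ᵥ f τ) (d ⬝ᵥ f') s t :=
  HasDerivWithinAt.fun_sum fun i _ => ((hasDerivWithinAt_pi.mp h) i).const_mul (d i)

theorem ContinuousOn.dotProduct_fun {n : ℕ} {f g : ℝ → Fin n → ℝ} {s : Set ℝ}
    (hf : ContinuousOn f s) (hg : ContinuousOn g s) : ContinuousOn (fun τ => f τ ⬝ᵥ g τ) s :=
  continuousOn_finsetSum _ fun i _ =>
    ((continuousOn_pi.mp hf) i).mul ((continuousOn_pi.mp hg) i)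

theorem StrictlyProperSystem.continuousOn_response (C : StrictlyProperSystem) {v : ℝ → ℝ}
    (hv : ContinuousOn v (Ici 0)) : ContinuousOn (C.response v) (Ici 0) :=
  continuousOn_causal_convolution C.continuous_impulse hv

theorem StrictlyProperSystem.response_add (C : StrictlyProperSystem) {v w : ℝ → ℝ}
    (hv : ContinuousOn v (Ici 0)) (hw : ContinuousOn w (Ici 0)) {t : ℝ} (ht : 0 ≤ t) :
    C.response (fun τ => v τ + w τ) t = C.response v t + C.response w t := by
  simp only [StrictlyProperSystem.response, mul_add]
  exact intervalIntegral.integral_add (intervalIntegrable_causal C.continuous_impulse hv ht)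
    (intervalIntegrable_causal C.continuous_impulse hw ht)

theorem StrictlyProperSystem.exists_abs_response_le (C : StrictlyProperSystem)
    (hC : C.IsStable) : ∃ c : ℝ, 0 ≤ c ∧ ∀ (v : ℝ → ℝ) (W t : ℝ), 0 ≤ t →
      (∀ τ, 0 ≤ τ → τ ≤ t → |v τ| ≤ W) → |C.response v t| ≤ c * W := by
  obtain ⟨c, hc, h⟩ := IsHurwitz.exists_integral_abs_le hC C.c C.b
  refine ⟨c, hc, fun v W t ht hv => ?_⟩
  have hW : 0 ≤ W := (abs_nonneg _).trans (hv 0 le_rfl ht)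
  exact (abs_causal_convolution_le C.continuous_impulse ht hv).trans
    (mul_le_mul_of_nonneg_right (h t ht) hW)

/-- If `η` drives a linear system from zero initial state along `b ≠ 0`, then a stable strictly
proper filter, applied to `η`, is bounded by a multiple of the state of the system. -/
theorem exists_abs_response_le_of_state (C : StrictlyProperSystem) (hC : C.IsStable) {n : ℕ}
    (A : Matrix (Fin n) (Fin n) ℝ) {b : Fin n → ℝ} (hb : b ≠ 0) :
    ∃ κ : ℝ, 0 ≤ κ ∧ ∀ (z : ℝ → Fin n → ℝ) (η : ℝ → ℝ), ContinuousOn η (Ici 0) → z 0 = 0 →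
      (∀ t, 0 ≤ t → HasDerivWithinAt z (A *ᵥ z t - η t • b) (Ici 0) t) →
      ∀ X t, 0 ≤ t → (∀ τ, 0 ≤ τ → τ ≤ t → ‖z τ‖ ≤ X) → |C.response η t| ≤ κ * X := by
  obtain ⟨c₀, hc₀, hk⟩ := IsHurwitz.exists_integral_abs_le hC C.c C.b
  obtain ⟨c₁, hc₁, hk'⟩ := IsHurwitz.exists_integral_abs_le hC C.c (C.A *ᵥ C.b)
  -- Pairing the state equation with `b` solves it for the input: `β η = bᵀ A z - (bᵀ z)'`.
  set β := b ⬝ᵥ b with hβ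
  have hβ0 : 0 < β := by
    have h0 : 0 ≤ β := Finset.sum_nonneg fun i _ => mul_self_nonneg (b i)
    exact lt_of_le_of_ne h0 fun h => hb (dotProduct_self_eq_zero.mp h.symm)
  set D₁ := ∑ i, |(b ᵥ* A) i|
  set D₂ := ∑ i, |b i|
  have hD₁ : 0 ≤ D₁ := Finset.sum_nonneg fun i _ => abs_nonneg _
  have hD₂ : 0 ≤ D₂ := Finset.sum_nonneg fun i _ => abs_nonneg _
  -- The terms bound, in order, `bᵀ A z` filtered by `C`, `bᵀ z` filtered by the derivative of the
  -- impulse response, and the boundary term at `τ = t`; the one at `0` vanishes with `z 0`.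
  refine ⟨(c₀ * D₁ + c₁ * D₂ + |C.impulse 0| * D₂) / β, by positivity, ?_⟩
  intro z η hη hz0 hz X t ht hX
  have hX0 : 0 ≤ X := (norm_nonneg _).trans (hX 0 le_rfl ht)
  have hzc : ContinuousOn z (Ici 0) := HasDerivWithinAt.continuousOn_Ici hz
  set k' : ℝ → ℝ := fun s => C.c ⬝ᵥ stateImpulse C.A (C.A *ᵥ C.b) s with hk'def
  have hk'c : Continuous k' := continuous_const.dotProduct (continuous_stateImpulse _ _)
  have hφ : ContinuousOn (fun τ => b ⬝ᵥ z τ) (Ici 0) :=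
    ContinuousOn.dotProduct_fun continuousOn_const hzc
  have hψ : ContinuousOn (fun τ => (b ᵥ* A) ⬝ᵥ z τ) (Ici 0) :=
    ContinuousOn.dotProduct_fun continuousOn_const hzc
  have hder : ∀ τ, 0 ≤ τ → HasDerivWithinAt (fun s => C.impulse (t - s) * (b ⬝ᵥ z s))
      (C.impulse (t - τ) * ((b ᵥ* A) ⬝ᵥ z τ) - k' (t - τ) * (b ⬝ᵥ z τ)
        - β * (C.impulse (t - τ) * η τ)) (Ici 0) τ := by
    intro τ hτ
    have h1 := (hasDerivAt_dotProduct_stateImpulse C.A C.c C.b (t - τ)).comp_const_sub t τ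
    have h2 := h1.hasDerivWithinAt.mul (HasDerivWithinAt.const_dotProduct b (hz τ hτ))
    refine h2.congr_deriv ?_
    rw [dotProduct_sub, dotProduct_smul, dotProduct_mulVec, smul_eq_mul, ← hβ]
    simp only [hk'def, StrictlyProperSystem.impulse]
    ring
  have i1 := intervalIntegrable_causal C.continuous_impulse hψ ht
  have i2 := intervalIntegrable_causal hk'c hφ ht
  have i3 := (intervalIntegrable_causal C.continuous_impulse hη ht).const_mul β
  have hftc := integral_deriv_eq_sub_of_Ici hder ht ((i1.sub i2).sub i3)
  rw [intervalIntegral.integral_sub (i1.sub i2) i3, intervalIntegral.integral_sub i1 i2,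
    intervalIntegral.integral_const_mul, hz0, dotProduct_zero, mul_zero, sub_zero, sub_self]
    at hftc
  have b1 := abs_causal_convolution_le C.continuous_impulse ht
    (w := fun τ => (b ᵥ* A) ⬝ᵥ z τ) (W := D₁ * X) fun τ h0 h1 =>
      (abs_dotProduct_le _ _).trans (mul_le_mul_of_nonneg_left (hX τ h0 h1) hD₁)
  have b2 := abs_causal_convolution_le hk'c ht
    (w := fun τ => b ⬝ᵥ z τ) (W := D₂ * X) fun τ h0 h1 =>
      (abs_dotProduct_le _ _).trans (mul_le_mul_of_nonneg_left (hX τ h0 h1) hD₂)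
  have b3 : |C.impulse 0 * (b ⬝ᵥ z t)| ≤ |C.impulse 0| * (D₂ * X) := by
    rw [abs_mul]
    exact mul_le_mul_of_nonneg_left ((abs_dotProduct_le _ _).trans
      (mul_le_mul_of_nonneg_left (hX t ht le_rfl) hD₂)) (abs_nonneg _)
  have b1' := b1.trans (mul_le_mul_of_nonneg_right (hk t ht) (by positivity))
  have b2' := b2.trans (mul_le_mul_of_nonneg_right (hk' t ht) (by positivity))
  have hres : C.response η t = (∫ τ in (0 : ℝ)..t, C.impulse (t - τ) * η τ) := rfl
  rw [hres, div_mul_eq_mul_div, le_div_iff₀ hβ0,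
    show ∀ x : ℝ, |x| * β = |x * β| from fun x => by rw [abs_mul, abs_of_pos hβ0]]
  have heq : (∫ τ in (0 : ℝ)..t, C.impulse (t - τ) * η τ) * β =
      (∫ τ in (0 : ℝ)..t, C.impulse (t - τ) * ((b ᵥ* A) ⬝ᵥ z τ))
        - (∫ τ in (0 : ℝ)..t, k' (t - τ) * (b ⬝ᵥ z τ)) - C.impulse 0 * (b ⬝ᵥ z t) := by
    linarith
  rw [heq]
  refine (abs_sub _ _).trans ((add_le_add ((abs_sub _ _).trans (add_le_add b1' b2')) b3).trans ?_)
  exact le_of_eq (by ring)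

end Filter

/-! ### The small-gain estimate. -/

namespace Data

variable {n : ℕ} (S : Data n)

theorem continuous_gBar (i : Fin n) : Continuous fun t => S.gBar t i := by
  have h1 : Continuous fun t => stateImpulse S.Am S.b t i :=
    (continuous_apply i).comp (continuous_stateImpulse _ _)
  refine Continuous.sub ?_ h1
  refine intervalIntegral.continuous_parametric_intervalIntegral_of_continuous
    (f := fun t τ => stateImpulse S.Am S.b (t - τ) i * S.C.impulse τ) ?_ continuous_id
  exact (h1.comp (continuous_fst.sub continuous_snd)).mul
    (S.C.continuous_impulse.comp continuous_snd)

/-- Truncating the integrals at `t` only decreases them. Finiteness of the product, rather than of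
the gain itself, is enough to pass to real numbers. -/
theorem GainRequirement.exists_lt_one {S : Data n} (h : S.GainRequirement) :
    ∃ ρ : ℝ, 0 ≤ ρ ∧ ρ < 1 ∧ ∀ t, 0 ≤ t → ∀ i,
      (∫ τ in (0 : ℝ)..t, |S.gBar τ i|) * S.thetaMax ≤ ρ := by
  have hlt : l1Gain S.gBar * ENNReal.ofReal S.thetaMax < 1 := h
  refine ⟨(l1Gain S.gBar * ENNReal.ofReal S.thetaMax).toReal, ENNReal.toReal_nonneg, ?_, ?_⟩
  · have := (ENNReal.toReal_lt_toReal (hlt.trans ENNReal.one_lt_top).ne ENNReal.one_ne_top).mpr hlt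
    simpa using this
  · intro t ht i
    rw [← ENNReal.ofReal_le_iff_le_toReal (hlt.trans ENNReal.one_lt_top).ne, ENNReal.ofReal_mul
      (intervalIntegral.integral_nonneg ht fun _ _ => abs_nonneg _)]
    refine mul_le_mul_left ?_ _
    rw [intervalIntegral.integral_of_le ht, ofReal_integral_eq_lintegral_ofReal]
    · refine (lintegral_mono_set Ioc_subset_Ioi_self).trans ?_
      exact le_iSup (fun i => ∫⁻ t in Ioi (0 : ℝ), ENNReal.ofReal |S.gBar t i|) i
    · exact ((S.continuous_gBar i).abs.intervalIntegrable 0 t).1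
    · exact Eventually.of_forall fun _ => abs_nonneg _

theorem sum_abs_le_thetaMax (hΩ : IsCompact S.Ω) (hθ : S.θ ∈ S.Ω) :
    ∑ i, |S.θ i| ≤ S.thetaMax := by
  refine le_csSup ?_ (mem_image_of_mem (fun ϑ : Fin n → ℝ => ∑ i, |ϑ i|) hθ)
  exact (hΩ.image (by fun_prop)).bddAbove

theorem mulVec_Am (x : Fin n → ℝ) : S.Am *ᵥ x = S.A *ᵥ x - (S.K ⬝ᵥ x) • S.b := by
  rw [Data.Am, Matrix.sub_mulVec, Matrix.vecMulVec_mulVec, op_smul_eq_smul]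

/-- Small-gain bound for the closed loop `e = Ḡ (θᵀ e) + H_o d`. -/
theorem exists_norm_error_le (hΩ : IsCompact S.Ω) (hθ : S.θ ∈ S.Ω) (hAm : IsHurwitz S.Am)
    (hgain : S.GainRequirement) : ∃ κ : ℝ, 0 ≤ κ ∧ ∀ (e : ℝ → Fin n → ℝ) (d : ℝ → ℝ),
      ContinuousOn d (Ici 0) → e 0 = 0 →
      (∀ t, 0 ≤ t → HasDerivWithinAt e (S.Am *ᵥ e t +
        (S.C.response (fun τ => S.θ ⬝ᵥ e τ) t - S.θ ⬝ᵥ e t + d t) • S.b) (Ici 0) t) →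
      ∀ δ t, 0 ≤ t → (∀ τ, 0 ≤ τ → τ ≤ t → |d τ| ≤ δ) → ‖e t‖ ≤ κ * δ := by
  obtain ⟨ρ, hρ0, hρ1, hρ⟩ := hgain.exists_lt_one
  choose c hc0 hc using fun i => hAm.exists_integral_abs_le (Pi.single i 1) S.b
  simp only [single_one_dotProduct] at hc
  have hcs : ∀ i, c i ≤ ∑ j, c j := fun i =>
    Finset.single_le_sum (fun j _ => hc0 j) (Finset.mem_univ i)
  have hsum0 : 0 ≤ ∑ j, c j := Finset.sum_nonneg fun j _ => hc0 j
  have hρ' : 0 < 1 - ρ := by linarith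
  refine ⟨(∑ j, c j) / (1 - ρ), by positivity, ?_⟩
  intro e d hd he0 he δ t ht hδ
  have hδ0 : 0 ≤ δ := (abs_nonneg _).trans (hδ 0 le_rfl ht)
  have hec : ContinuousOn e (Ici 0) := HasDerivWithinAt.continuousOn_Ici he
  set w : ℝ → ℝ := fun τ => S.θ ⬝ᵥ e τ with hw
  have hwc : ContinuousOn w (Ici 0) := ContinuousOn.dotProduct_fun continuousOn_const hec
  have hrep : ∀ s, 0 ≤ s → ∀ i, e s i = (∫ τ in (0 : ℝ)..s, S.gBar (s - τ) i * w τ)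
      + ∫ τ in (0 : ℝ)..s, stateImpulse S.Am S.b (s - τ) i * d τ := by
    intro s hs i
    have hh : Continuous fun t => stateImpulse S.Am S.b t i :=
      (continuous_apply i).comp (continuous_stateImpulse _ _)
    have hrc := S.C.continuousOn_response hwc
    rw [variation_of_constants (v := fun τ => S.C.response w τ - w τ + d τ)
      ((hrc.sub hwc).add hd) he0 he hs i]
    simp only [mul_add, mul_sub]
    have j1 := intervalIntegrable_causal hh hrc hs
    have j2 := intervalIntegrable_causal hh hwc hs
    have j3 := intervalIntegrable_causal hh hd hs
    rw [intervalIntegral.integral_add (j1.sub j2) j3, intervalIntegral.integral_sub j1 j2]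
    -- By associativity, `H_o` after `C` has impulse response `h * k`, which is `gBar + h` by
    -- definition of `gBar`.
    have hassoc : ∫ τ in (0 : ℝ)..s, stateImpulse S.Am S.b (s - τ) i * S.C.response w τ =
        ∫ τ in (0 : ℝ)..s, (S.gBar (s - τ) i + stateImpulse S.Am S.b (s - τ) i) * w τ := by
      refine (causal_convolution_assoc hh S.C.continuous_impulse hwc hs).trans ?_
      simp only [Data.gBar, sub_add_cancel]
    have hgi : Continuous fun t => S.gBar t i + stateImpulse S.Am S.b t i :=
      (S.continuous_gBar i).add hh
    rw [hassoc, ← intervalIntegral.integral_sub (intervalIntegrable_causal hgi hwc hs) j2]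
    congr 1
    refine intervalIntegral.integral_congr fun τ _ => ?_
    ring
  -- At a maximum point of `‖e‖` on `[0, t]` the inequality bounds `‖e s‖` by itself times `ρ < 1`
  -- plus a remainder, so no a priori bound on `e` is required.
  obtain ⟨s, hs, hmax⟩ := (isCompact_Icc (a := (0 : ℝ)) (b := t)).exists_isMaxOn
    (nonempty_Icc.mpr ht) (hec.mono Icc_subset_Ici_self).norm
  have hle : ∀ τ, 0 ≤ τ → τ ≤ s → |w τ| ≤ S.thetaMax * ‖e s‖ := by
    intro τ h0 h1
    refine (abs_dotProduct_le _ _).trans ?_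
    exact mul_le_mul (S.sum_abs_le_thetaMax hΩ hθ) (hmax ⟨h0, h1.trans hs.2⟩) (norm_nonneg _)
      ((Finset.sum_nonneg fun i _ => abs_nonneg _).trans (S.sum_abs_le_thetaMax hΩ hθ))
  have hbound : ‖e s‖ ≤ ρ * ‖e s‖ + (∑ j, c j) * δ := by
    refine (pi_norm_le_iff_of_nonneg (by positivity)).mpr fun i => ?_
    rw [hrep s hs.1 i, Real.norm_eq_abs]
    refine (abs_add_le _ _).trans (add_le_add ?_ ?_)
    · refine (abs_causal_convolution_le (S.continuous_gBar i) hs.1 hle).trans ?_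
      rw [← mul_assoc]
      exact mul_le_mul_of_nonneg_right (hρ s hs.1 i) (norm_nonneg _)
    · refine (abs_causal_convolution_le
        ((continuous_apply i).comp (continuous_stateImpulse S.Am S.b)) hs.1
        fun τ h0 h1 => hδ τ h0 (h1.trans hs.2)).trans ?_
      exact mul_le_mul_of_nonneg_right ((hc i s hs.1).trans (hcs i)) hδ0
  refine (hmax ⟨ht, le_rfl⟩ : ‖e t‖ ≤ ‖e s‖).trans ?_
  rw [div_mul_eq_mul_div, le_div_iff₀ hρ']
  linarith

end Data

/-! ### The Lyapunov equation: symmetry and positivity of `P`. -/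

section LyapunovEquation

variable {n : ℕ}

theorem IsHurwitz.tendsto_exp_mulVec {A : Matrix (Fin n) (Fin n) ℝ} (hA : IsHurwitz A)
    (v : Fin n → ℝ) :
    Tendsto (fun t : ℝ => NormedSpace.exp (t • A) *ᵥ v) atTop (𝓝 0) := by
  obtain ⟨α, hα, h⟩ := hA.exists_exp_isBigO
  refine (h v).trans_tendsto ?_
  exact Real.tendsto_exp_atBot.comp (tendsto_id.const_mul_atTop_of_neg (by linarith))

theorem hasDerivWithinAt_dotProduct_mulVec {f g : ℝ → Fin n → ℝ} {f' g' : Fin n → ℝ}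
    (D : Matrix (Fin n) (Fin n) ℝ) {s : Set ℝ} {t : ℝ} (hf : HasDerivWithinAt f f' s t)
    (hg : HasDerivWithinAt g g' s t) :
    HasDerivWithinAt (fun τ => f τ ⬝ᵥ (D *ᵥ g τ)) (f' ⬝ᵥ (D *ᵥ g t) + f t ⬝ᵥ (D *ᵥ g')) s t := by
  have h1 : ∀ i, HasDerivWithinAt (fun τ => (D *ᵥ g τ) i) ((D *ᵥ g') i) s t := fun i =>
    HasDerivWithinAt.const_dotProduct (D i) hg
  have h2 := HasDerivWithinAt.fun_sum (u := Finset.univ) fun i _ =>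
    ((hasDerivWithinAt_pi.mp hf) i).mul (h1 i)
  rw [Finset.sum_add_distrib] at h2
  exact h2

theorem hasDerivAt_flow_form (A D : Matrix (Fin n) (Fin n) ℝ) (z w : Fin n → ℝ) (t : ℝ) :
    HasDerivAt (fun τ : ℝ => (NormedSpace.exp (τ • A) *ᵥ z) ⬝ᵥ
        (D *ᵥ (NormedSpace.exp (τ • A) *ᵥ w)))
      ((NormedSpace.exp (t • A) *ᵥ z) ⬝ᵥ
        ((Aᵀ * D + D * A) *ᵥ (NormedSpace.exp (t • A) *ᵥ w))) t := by
  have h := hasDerivWithinAt_dotProduct_mulVec D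
    (hasDerivAt_exp_smul_mulVec A z t).hasDerivWithinAt (s := univ)
    (hasDerivAt_exp_smul_mulVec A w t).hasDerivWithinAt
  rw [hasDerivWithinAt_univ] at h
  refine h.congr_deriv ?_
  rw [Matrix.add_mulVec, dotProduct_add, ← Matrix.mulVec_mulVec, ← Matrix.mulVec_mulVec]
  congr 1
  rw [Matrix.dotProduct_mulVec _ Aᵀ, Matrix.vecMul_transpose]

theorem IsHurwitz.tendsto_flow_form {A : Matrix (Fin n) (Fin n) ℝ} (hA : IsHurwitz A)
    (D : Matrix (Fin n) (Fin n) ℝ) (z w : Fin n → ℝ) :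
    Tendsto (fun τ : ℝ => (NormedSpace.exp (τ • A) *ᵥ z) ⬝ᵥ
        (D *ᵥ (NormedSpace.exp (τ • A) *ᵥ w))) atTop (𝓝 0) := by
  have hc : Continuous fun p : (Fin n → ℝ) × (Fin n → ℝ) => p.1 ⬝ᵥ (D *ᵥ p.2) :=
    continuous_fst.dotProduct (continuous_const.matrix_mulVec continuous_snd)
  have := (hc.tendsto (0, 0)).comp
    ((hA.tendsto_exp_mulVec z).prodMk_nhds (hA.tendsto_exp_mulVec w))
  simpa [Function.comp_def] using this

/-- The homogeneous Lyapunov equation of a Hurwitz matrix has only the zero solution. -/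
theorem IsHurwitz.eq_zero_of_lyapunov {A D : Matrix (Fin n) (Fin n) ℝ} (hA : IsHurwitz A)
    (hD : Aᵀ * D + D * A = 0) : D = 0 := by
  have key : ∀ z w : Fin n → ℝ, z ⬝ᵥ (D *ᵥ w) = 0 := by
    intro z w
    have hder := hasDerivAt_flow_form A D z w
    simp only [hD, Matrix.zero_mulVec, dotProduct_zero] at hder
    -- Along the flow the bilinear form of `D` is constant, yet it tends to zero.
    have hconst := is_const_of_deriv_eq_zero (fun t => (hder t).differentiableAt)
      fun t => (hder t).deriv
    have h0 := hA.tendsto_flow_form D z w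
    have h1 := h0.congr fun t => hconst t 0
    have h2 := tendsto_nhds_unique h1 tendsto_const_nhds
    simpa [NormedSpace.exp_zero] using h2.symm
  ext i j
  have := key (Pi.single i 1) (Pi.single j 1)
  simpa using this

/-- `Pᵀ` solves the same equation as `P`, so uniqueness identifies them. -/
theorem IsHurwitz.lyapunov_isSymm {A P Q : Matrix (Fin n) (Fin n) ℝ} (hA : IsHurwitz A)
    (hQ : Q.PosDef) (hP : Aᵀ * P + P * A = -Q) : Pᵀ = P := by
  have hQt : Qᵀ = Q := by
    have := hQ.isHermitian
    rwa [Matrix.IsHermitian, Matrix.conjTranspose_eq_transpose_of_trivial] at this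
  have hPt : Aᵀ * Pᵀ + Pᵀ * A = -Q := by
    have := congrArg Matrix.transpose hP
    rw [Matrix.transpose_add, Matrix.transpose_mul, Matrix.transpose_mul,
      Matrix.transpose_transpose, Matrix.transpose_neg, hQt, add_comm] at this
    exact this
  refine sub_eq_zero.mp (hA.eq_zero_of_lyapunov ?_)
  rw [mul_sub, sub_mul, sub_add_sub_comm, hPt, hP, sub_self]

/-- Along the flow the quadratic form of `P` has derivative given by `-Q`, so it decreases strictly
to its limit `0` and must start positive. -/
theorem IsHurwitz.lyapunov_pos {A P Q : Matrix (Fin n) (Fin n) ℝ} (hA : IsHurwitz A)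
    (hQ : Q.PosDef) (hP : Aᵀ * P + P * A = -Q) {z : Fin n → ℝ} (hz : z ≠ 0) :
    0 < z ⬝ᵥ (P *ᵥ z) := by
  set f : ℝ → ℝ := fun τ => (NormedSpace.exp (τ • A) *ᵥ z) ⬝ᵥ
        (P *ᵥ (NormedSpace.exp (τ • A) *ᵥ z)) with hf
  have hne : ∀ t : ℝ, NormedSpace.exp (t • A) *ᵥ z ≠ 0 := by
    intro t h
    refine hz (Matrix.mulVec_injective_of_isUnit (Matrix.isUnit_exp (t • A)) ?_)
    simpa using h
  have hanti : StrictAnti f := by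
    refine strictAnti_of_hasDerivAt_neg (fun t => hasDerivAt_flow_form A P z z t) fun t => ?_
    rw [hP, Matrix.neg_mulVec, dotProduct_neg, neg_lt_zero]
    simpa using hQ.dotProduct_mulVec_pos (hne t)
  have h0 : Tendsto f atTop (𝓝 0) := hA.tendsto_flow_form P z z
  have h1 : 0 ≤ f 1 := hanti.antitone.le_of_tendsto h0 1
  have h2 : f 1 < f 0 := hanti one_pos
  have h3 : f 0 = z ⬝ᵥ (P *ᵥ z) := by simp [hf, NormedSpace.exp_zero]
  linarith

/-- `μ` is the minimum of the form on the unit sphere, extended by homogeneity; the sphere is empty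
when `n = 0`. -/
theorem exists_mul_norm_sq_le {P : Matrix (Fin n) (Fin n) ℝ}
    (hP : ∀ z : Fin n → ℝ, z ≠ 0 → 0 < z ⬝ᵥ (P *ᵥ z)) :
    ∃ μ : ℝ, 0 < μ ∧ ∀ z : Fin n → ℝ, μ * ‖z‖ ^ 2 ≤ z ⬝ᵥ (P *ᵥ z) := by
  have hc : Continuous fun z : Fin n → ℝ => z ⬝ᵥ (P *ᵥ z) :=
    continuous_id.dotProduct (continuous_const.matrix_mulVec continuous_id)
  rcases (Metric.sphere (0 : Fin n → ℝ) 1).eq_empty_or_nonempty with he | hne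
  · refine ⟨1, one_pos, fun z => ?_⟩
    have hz : z = 0 := by
      by_contra h
      have : ‖z‖⁻¹ • z ∈ Metric.sphere (0 : Fin n → ℝ) 1 := by
        rw [mem_sphere_zero_iff_norm, norm_smul, norm_inv, norm_norm,
          inv_mul_cancel₀ (norm_ne_zero_iff.mpr h)]
      rw [he] at this
      exact this
    simp [hz]
  · obtain ⟨p, hp, hmin⟩ := (isCompact_sphere (0 : Fin n → ℝ) 1).exists_isMinOn hne hc.continuousOn
    have hp0 : p ≠ 0 := by
      rintro rfl
      simp at hp
    refine ⟨p ⬝ᵥ (P *ᵥ p), hP p hp0, fun z => ?_⟩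
    by_cases hz : z = 0
    · simp [hz]
    have hzn : ‖z‖ ≠ 0 := norm_ne_zero_iff.mpr hz
    have hmem : ‖z‖⁻¹ • z ∈ Metric.sphere (0 : Fin n → ℝ) 1 := by
      rw [mem_sphere_zero_iff_norm, norm_smul, norm_inv, norm_norm, inv_mul_cancel₀ hzn]
    have h1 : p ⬝ᵥ (P *ᵥ p) ≤ (‖z‖⁻¹ • z) ⬝ᵥ (P *ᵥ (‖z‖⁻¹ • z)) := hmin hmem
    rw [Matrix.mulVec_smul, dotProduct_smul, smul_dotProduct, smul_eq_mul, smul_eq_mul] at h1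
    calc p ⬝ᵥ (P *ᵥ p) * ‖z‖ ^ 2 ≤ (‖z‖⁻¹ * (‖z‖⁻¹ * z ⬝ᵥ (P *ᵥ z))) * ‖z‖ ^ 2 := by gcongr
      _ = z ⬝ᵥ (P *ᵥ z) := by field_simp

end LyapunovEquation

/-! ### Projection onto the tangent cone of a convex set. -/

section Projection

variable {n : ℕ}

/-- Moving a tangent direction of a convex set towards a point of the set keeps it tangent. -/
theorem add_smul_sub_mem_posTangentConeAt {Ω : Set (Fin n → ℝ)} (hΩ : Convex ℝ Ω)
    {ϑ z v : Fin n → ℝ} (hϑ : ϑ ∈ Ω) (hz : z ∈ Ω) (hv : v ∈ posTangentConeAt Ω ϑ) {s : ℝ}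
    (hs : 0 ≤ s) : v + s • (z - ϑ) ∈ posTangentConeAt Ω ϑ := by
  obtain ⟨ι, l, hl, c, d, hd0, hdΩ, hcd⟩ := exists_fun_of_mem_tangentConeAt hv
  -- The scale `c` need not diverge, for instance when `v = 0`. Adding an independent index `p.2`
  -- forces `q → ∞`, so the new increments tend to zero while `q` times them still equals `c d + s
  -- (z - ϑ)`.
  let q : ι × ℕ → ℝ := fun p => (c p.1 : ℝ) + p.2
  have hq : Tendsto q (l ×ˢ atTop) atTop := by
    refine tendsto_atTop_mono (fun p => ?_)
      (tendsto_natCast_atTop_atTop.comp (tendsto_snd (f := l) (g := atTop)))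
    simp only [q, Function.comp_apply]
    linarith [(c p.1).2]
  refine mem_tangentConeAt_of_seq (l ×ˢ (atTop : Filter ℕ)) (fun p => c p.1 + p.2)
    (fun p => ((c p.1 : ℝ) / q p) • d p.1 + (s / q p) • (z - ϑ)) ?_ ?_ ?_
  · have h1 : Tendsto (fun p : ι × ℕ => ((c p.1 : ℝ) / q p) • d p.1) (l ×ˢ atTop) (𝓝 0) := by
      refine squeeze_zero_norm (fun p => ?_) ((tendsto_norm_zero.comp hd0).comp tendsto_fst)
      rw [norm_smul, Function.comp_apply, Function.comp_apply]
      refine mul_le_of_le_one_left (norm_nonneg _) ?_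
      have hc0 : (0 : ℝ) ≤ c p.1 := (c p.1).2
      have hp0 : (0 : ℝ) ≤ p.2 := Nat.cast_nonneg _
      have hq0 : 0 ≤ q p := add_nonneg hc0 hp0
      rw [Real.norm_eq_abs, abs_of_nonneg (div_nonneg hc0 hq0)]
      exact div_le_one_of_le₀ (by simp only [q]; linarith) hq0
    have h2 : Tendsto (fun p : ι × ℕ => (s / q p) • (z - ϑ)) (l ×ˢ atTop) (𝓝 0) := by
      simpa using (hq.const_div_atTop s).smul_const (z - ϑ)
    simpa using h1.add h2
  · have hlarge : ∀ᶠ p : ι × ℕ in l ×ˢ atTop, s + 1 ≤ (p.2 : ℝ) :=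
      (tendsto_natCast_atTop_atTop.comp (tendsto_snd (f := l) (g := atTop))).eventually_ge_atTop _
    filter_upwards [tendsto_fst.eventually hdΩ, hlarge] with p hp1 hp2
    have hc0 : (0 : ℝ) ≤ c p.1 := (c p.1).2
    have hq0 : 0 < q p := by simp only [q]; linarith
    have hsum : (c p.1 : ℝ) / q p + s / q p ≤ 1 := by
      rw [← add_div]
      exact div_le_one_of_le₀ (by simp only [q]; linarith) hq0.le
    -- The displaced point is a convex combination of `ϑ + d`, `z` and `ϑ`; the last weight is
    -- nonnegative once `p.2 ≥ s`.
    have hcomb := hΩ.sum_mem (t := Finset.univ)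
      (w := ![(c p.1 : ℝ) / q p, s / q p, 1 - ((c p.1 : ℝ) / q p + s / q p)])
      (z := ![ϑ + d p.1, z, ϑ]) ?_ ?_ ?_
    · convert hcomb using 1
      simp only [Fin.sum_univ_three, Matrix.cons_val_zero, Matrix.cons_val_one, Matrix.cons_val]
      module
    · intro i _
      fin_cases i
      · exact div_nonneg hc0 hq0.le
      · exact div_nonneg hs hq0.le
      · simpa using hsum
    · simp [Fin.sum_univ_three]
    · intro i _
      fin_cases i
      · exact hp1
      · exact hz
      · exact hϑ
  · have hev : ∀ᶠ p in l ×ˢ (atTop : Filter ℕ), c p.1 • d p.1 + s • (z - ϑ) =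
        ((c p.1 : NNReal) + (p.2 : NNReal)) •
          (((c p.1 : ℝ) / q p) • d p.1 + (s / q p) • (z - ϑ)) := by
      filter_upwards [hq.eventually_gt_atTop 0] with p hp
      have hcoe : ((c p.1 : NNReal) + (p.2 : NNReal)) •
          (((c p.1 : ℝ) / q p) • d p.1 + (s / q p) • (z - ϑ)) =
          q p • (((c p.1 : ℝ) / q p) • d p.1 + (s / q p) • (z - ϑ)) := by
        rw [NNReal.smul_def]; simp [q]
      rw [hcoe, smul_add, smul_smul, smul_smul, mul_div_cancel₀ _ hp.ne', mul_div_cancel₀ _ hp.ne',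
        NNReal.smul_def]
    refine Tendsto.congr' hev ?_
    exact (hcd.comp tendsto_fst).add_const _

/-- A nonempty tangent cone already forces its base point into the closure, so the adaptive law
itself keeps the estimate in `Ω` almost everywhere and no invariance argument is needed. -/
theorem IsProj.mem {Ω : Set (Fin n → ℝ)} (hΩ : IsClosed Ω) {ϑ y v : Fin n → ℝ}
    (h : IsProj Ω ϑ y v) : ϑ ∈ Ω :=
  hΩ.closure_eq ▸ mem_closure_of_nonempty_tangentConeAt ⟨v, h.1⟩

/-- The variational inequality of the projection onto the tangent cone of a convex set. -/
theorem IsProj.dotProduct_nonpos {Ω : Set (Fin n → ℝ)} (hΩ : Convex ℝ Ω) {ϑ y v z : Fin n → ℝ}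
    (h : IsProj Ω ϑ y v) (hϑ : ϑ ∈ Ω) (hz : z ∈ Ω) : (z - ϑ) ⬝ᵥ (y - v) ≤ 0 := by
  set w := z - ϑ with hw
  -- First-order optimality: compare `v` with the competitor `v + s w`, divide by `s`, then let `s →
  -- 0`.
  have key : ∀ s : ℝ, 0 < s → 2 * (w ⬝ᵥ (y - v)) ≤ s * (w ⬝ᵥ w) := by
    intro s hs
    have h1 := h.2 _ (add_smul_sub_mem_posTangentConeAt hΩ hϑ hz h.1 hs.le)
    rw [← hw, ← sub_sub] at h1
    generalize y - v = a at h1 ⊢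
    rw [sub_dotProduct, dotProduct_sub, dotProduct_sub, smul_dotProduct, dotProduct_smul,
      smul_dotProduct, dotProduct_smul, dotProduct_comm a w] at h1
    simp only [smul_eq_mul] at h1
    have h2 : s * (2 * (w ⬝ᵥ a)) ≤ s * (s * (w ⬝ᵥ w)) := by linarith
    exact le_of_mul_le_mul_left h2 hs
  have hlim : Tendsto (fun s : ℝ => s * (w ⬝ᵥ w)) (𝓝[>] 0) (𝓝 0) := by
    have : Tendsto (fun s : ℝ => s * (w ⬝ᵥ w)) (𝓝 0) (𝓝 (0 * (w ⬝ᵥ w))) :=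
      tendsto_id.mul_const _
    rw [zero_mul] at this
    exact this.mono_left nhdsWithin_le_nhds
  have := ge_of_tendsto hlim (eventually_nhdsWithin_of_forall fun s hs => key s hs)
  linarith

end Projection

/-! ### Absolutely continuous estimates. -/

section AbsoluteContinuity

theorem AbsolutelyContinuousOnInterval.apply_sub_const {n : ℕ} {f : ℝ → Fin n → ℝ} {a b : ℝ}
    (hf : AbsolutelyContinuousOnInterval f a b) (i : Fin n) (c : ℝ) :
    AbsolutelyContinuousOnInterval (fun t => f t i - c) a b := by
  refine squeeze_zero (fun E => Finset.sum_nonneg fun _ _ => dist_nonneg) (fun E => ?_) hf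
  refine Finset.sum_le_sum fun j _ => ?_
  rw [dist_sub_right]
  exact dist_le_pi_dist _ _ i

theorem AbsolutelyContinuousOnInterval.continuousOn_Ici {E : Type*} [NormedAddCommGroup E]
    {f : ℝ → E} (hf : ∀ T, 0 < T → AbsolutelyContinuousOnInterval f 0 T) :
    ContinuousOn f (Ici 0) := by
  intro t ht
  have ht' : (0 : ℝ) ≤ t := ht
  have h := (hf (t + 1) (by linarith)).continuousOn
  rw [uIcc_of_le (by linarith)] at h
  refine (h t ⟨ht', by linarith⟩).mono_of_mem_nhdsWithin ?_
  filter_upwards [self_mem_nhdsWithin, nhdsWithin_le_nhds (Iic_mem_nhds (lt_add_one t))]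
    with s hs1 hs2 using ⟨hs1, hs2⟩

end AbsoluteContinuity

/-! ### Prediction and tracking errors of the adaptive loop. -/

namespace Data

variable {n : ℕ} {S : Data n}

theorem IsPlantSolution.continuousOn {x : ℝ → Fin n → ℝ} {u : ℝ → ℝ}
    (h : S.IsPlantSolution x u) : ContinuousOn x (Ici 0) :=
  HasDerivWithinAt.continuousOn_Ici h.2

namespace IsAdaptiveLoop

variable {Γc : ℝ} {x xhat θhat : ℝ → Fin n → ℝ} {u : ℝ → ℝ}

theorem continuousOn_estimate (h : S.IsAdaptiveLoop Γc x xhat θhat u) :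
    ContinuousOn θhat (Ici 0) :=
  AbsolutelyContinuousOnInterval.continuousOn_Ici h.estimate_ac

theorem continuousOn_mismatch (h : S.IsAdaptiveLoop Γc x xhat θhat u) :
    ContinuousOn (fun τ => (θhat τ - S.θ) ⬝ᵥ x τ) (Ici 0) :=
  ContinuousOn.dotProduct_fun (h.continuousOn_estimate.sub continuousOn_const)
    h.plant.continuousOn

theorem prediction_error_zero (h : S.IsAdaptiveLoop Γc x xhat θhat u) : xhat 0 - x 0 = 0 := by
  rw [h.predictor_init, h.plant.1, sub_self]

/-- The filtered control enters plant and predictor alike and cancels, leaving only the parameter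
mismatch as input. -/
theorem hasDerivWithinAt_prediction_error (h : S.IsAdaptiveLoop Γc x xhat θhat u) {t : ℝ}
    (ht : 0 ≤ t) : HasDerivWithinAt (fun τ => xhat τ - x τ)
      (S.Am *ᵥ (xhat t - x t) - ((θhat t - S.θ) ⬝ᵥ x t) • S.b) (Ici 0) t := by
  refine ((h.predictor t ht).sub (h.plant.2 t ht)).congr_deriv ?_
  rw [h.control t ht, Matrix.mulVec_sub, S.mulVec_Am (x t), sub_dotProduct]
  module

/-- The Lyapunov estimate for the prediction error. -/
theorem lyapunov_le (h : S.IsAdaptiveLoop Γc x xhat θhat u) (hΓ : 0 < Γc)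
    {Q : Matrix (Fin n) (Fin n) ℝ} (hΩ_closed : IsClosed S.Ω) (hΩ_convex : Convex ℝ S.Ω)
    (hθ : S.θ ∈ S.Ω) (hQ : Q.PosDef) (hP : S.Amᵀ * S.P + S.P * S.Am = -Q) (hPs : S.Pᵀ = S.P)
    {t : ℝ} (ht : 0 ≤ t) :
    Γc * ((xhat t - x t) ⬝ᵥ (S.P *ᵥ (xhat t - x t))) ≤
      (S.θhat₀ - S.θ) ⬝ᵥ (S.θhat₀ - S.θ) := by
  rcases ht.eq_or_lt with rfl | ht0
  · rw [h.prediction_error_zero, zero_dotProduct, mul_zero]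
    exact Finset.sum_nonneg fun i _ => mul_self_nonneg _
  set z : ℝ → Fin n → ℝ := fun τ => xhat τ - x τ with hz
  set η : ℝ → ℝ := fun τ => (θhat τ - S.θ) ⬝ᵥ x τ with hη
  set V' : ℝ → ℝ := fun τ => -(z τ ⬝ᵥ (Q *ᵥ z τ)) - 2 * (η τ * (z τ ⬝ᵥ (S.P *ᵥ S.b))) with hV'
  have hzd : ∀ τ, 0 ≤ τ → HasDerivWithinAt z (S.Am *ᵥ z τ - η τ • S.b) (Ici 0) τ :=
    fun τ hτ => h.hasDerivWithinAt_prediction_error hτ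
  have hzc : ContinuousOn z (Ici 0) := HasDerivWithinAt.continuousOn_Ici hzd
  have hηc : ContinuousOn η (Ici 0) := h.continuousOn_mismatch
  have hVd : ∀ τ, 0 ≤ τ → HasDerivWithinAt (fun s => z s ⬝ᵥ (S.P *ᵥ z s)) (V' τ) (Ici 0) τ := by
    intro τ hτ
    refine (hasDerivWithinAt_dotProduct_mulVec S.P (hzd τ hτ) (hzd τ hτ)).congr_deriv ?_
    -- Symmetry of `P` merges the two cross terms into one that matches the regressor of the
    -- adaptive law.
    have h1 : S.b ⬝ᵥ (S.P *ᵥ z τ) = z τ ⬝ᵥ (S.P *ᵥ S.b) := by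
      rw [dotProduct_comm, ← Matrix.vecMul_transpose, hPs, ← Matrix.dotProduct_mulVec]
    have h2 : (S.Am *ᵥ z τ) ⬝ᵥ (S.P *ᵥ z τ) + z τ ⬝ᵥ (S.P *ᵥ (S.Am *ᵥ z τ)) =
        -(z τ ⬝ᵥ (Q *ᵥ z τ)) := by
      rw [← dotProduct_neg, ← Matrix.neg_mulVec, ← hP, Matrix.add_mulVec, dotProduct_add,
        ← Matrix.mulVec_mulVec, ← Matrix.mulVec_mulVec, Matrix.dotProduct_mulVec _ S.Amᵀ,
        Matrix.vecMul_transpose]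
    rw [Matrix.mulVec_sub S.P (S.Am *ᵥ z τ), Matrix.mulVec_smul, sub_dotProduct (S.Am *ᵥ z τ),
      dotProduct_sub _ (S.P *ᵥ (S.Am *ᵥ z τ)), smul_dotProduct,
      dotProduct_smul, h1]
    simp only [smul_eq_mul, hV']
    linarith
  have hQz : ContinuousOn (fun τ => Q *ᵥ z τ) (Ici 0) :=
    (continuous_const.matrix_mulVec continuous_id : Continuous fun y : Fin n → ℝ => Q *ᵥ y)
      |>.comp_continuousOn hzc
  have hV'c : ContinuousOn V' (Ici 0) :=
    (ContinuousOn.dotProduct_fun hzc hQz).neg.sub (continuousOn_const.mul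
      (hηc.mul (ContinuousOn.dotProduct_fun hzc continuousOn_const)))
  have hV'i : IntervalIntegrable V' volume 0 t := by
    refine ContinuousOn.intervalIntegrable ?_
    rw [uIcc_of_le ht]
    exact hV'c.mono Icc_subset_Ici_self
  have hV := integral_deriv_eq_sub_of_Ici hVd ht hV'i
  -- The estimate is differentiable only almost everywhere; absolute continuity of its squared error
  -- justifies the fundamental theorem of calculus.
  have hac : ∀ i, AbsolutelyContinuousOnInterval
      (fun τ => (θhat τ i - S.θ i) * (θhat τ i - S.θ i)) 0 t := fun i =>
    have := AbsolutelyContinuousOnInterval.apply_sub_const (h.estimate_ac t ht0) i (S.θ i)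
    this.fun_mul this
  have hsum : IntervalIntegrable (fun τ => ∑ i,
      deriv (fun τ => (θhat τ i - S.θ i) * (θhat τ i - S.θ i)) τ) volume 0 t := by
    refine (IntervalIntegrable.sum Finset.univ fun i _ => (hac i).intervalIntegrable_deriv).congr
      fun τ _ => ?_
    simp only [Finset.sum_apply]
  have htotal : ∫ τ in (0 : ℝ)..t, (Γc * V' τ + ∑ i,
      deriv (fun τ => (θhat τ i - S.θ i) * (θhat τ i - S.θ i)) τ) =
      Γc * (z t ⬝ᵥ (S.P *ᵥ z t)) + ((θhat t - S.θ) ⬝ᵥ (θhat t - S.θ)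
        - (S.θhat₀ - S.θ) ⬝ᵥ (S.θhat₀ - S.θ)) := by
    rw [intervalIntegral.integral_add (hV'i.const_mul Γc) hsum,
      intervalIntegral.integral_const_mul, hV,
      intervalIntegral.integral_finsetSum fun i _ => (hac i).intervalIntegrable_deriv]
    simp only [fun i => (hac i).integral_deriv_eq_sub]
    rw [Finset.sum_sub_distrib, h.estimate_init]
    have hz0 : z 0 = 0 := h.prediction_error_zero
    rw [hz0, zero_dotProduct, sub_zero]
    rfl
  have hneg : ∫ τ in (0 : ℝ)..t, (Γc * V' τ + ∑ i,
      deriv (fun τ => (θhat τ i - S.θ i) * (θhat τ i - S.θ i)) τ) ≤ 0 := by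
    rw [intervalIntegral.integral_of_le ht]
    refine integral_nonpos_of_ae ?_
    filter_upwards [ae_restrict_of_ae_restrict_of_subset
      (Ioc_subset_Ioi_self.trans Ioi_subset_Ici_self) h.adaptation] with τ hτ
    obtain ⟨v, hproj, hder⟩ := hτ
    have hd : ∀ i, deriv (fun τ => (θhat τ i - S.θ i) * (θhat τ i - S.θ i)) τ =
        2 * Γc * ((θhat τ i - S.θ i) * v i) := by
      intro i
      have h1 := ((hasDerivAt_pi.mp hder) i).sub_const (S.θ i)
      rw [(h1.fun_mul h1).deriv, Pi.smul_apply, smul_eq_mul]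
      ring
    have hsum : ∑ i, deriv (fun τ => (θhat τ i - S.θ i) * (θhat τ i - S.θ i)) τ =
        2 * Γc * ((θhat τ - S.θ) ⬝ᵥ v) := by
      rw [Finset.sum_congr rfl fun i _ => hd i, ← Finset.mul_sum]
      rfl
    -- Testing the variational inequality at `θ` gives `(θhat - θ)ᵀ v ≤ η zᵀ P b`, exactly what
    -- cancels the indefinite term of `V'`.
    have hvar := hproj.dotProduct_nonpos hΩ_convex (hproj.mem hΩ_closed) hθ
    rw [← neg_sub (θhat τ) S.θ, neg_dotProduct, dotProduct_sub, dotProduct_smul, smul_eq_mul]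
      at hvar
    have hQ0 : 0 ≤ z τ ⬝ᵥ (Q *ᵥ z τ) := by simpa using hQ.posSemidef.dotProduct_mulVec_nonneg (z τ)
    rw [hsum]
    have hkey : -(z τ ⬝ᵥ (Q *ᵥ z τ)) - 2 * (η τ * (z τ ⬝ᵥ (S.P *ᵥ S.b)))
        + 2 * ((θhat τ - S.θ) ⬝ᵥ v) ≤ 0 := by
      have : (z τ ⬝ᵥ (S.P *ᵥ S.b)) * η τ - (θhat τ - S.θ) ⬝ᵥ v ≥ 0 := by linarith
      linarith
    have := mul_nonpos_of_nonneg_of_nonpos hΓ.le hkey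
    simp only [hV', Pi.zero_apply]
    linarith
  have hpos : 0 ≤ (θhat t - S.θ) ⬝ᵥ (θhat t - S.θ) :=
    Finset.sum_nonneg fun i _ => mul_self_nonneg _
  linarith

end IsAdaptiveLoop

theorem b_ne_zero (h : transferAt S.Am S.b S.c 0 ≠ 0) : S.b ≠ 0 := by
  intro hb
  exact h (by rw [transferAt, hb, Matrix.mulVec_zero, dotProduct_zero])

/-- The signals of the adaptive loop differ from those of the reference system by at most a
constant multiple of the inverse square root of the adaptation gain. -/
theorem exists_tracking_bound {Q : Matrix (Fin n) (Fin n) ℝ}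
    (hΩ_compact : IsCompact S.Ω) (hΩ_convex : Convex ℝ S.Ω) (hθ : S.θ ∈ S.Ω)
    (hr : ContinuousOn S.r (Ici 0)) (hAm : IsHurwitz S.Am) (hQ : Q.PosDef)
    (hP : S.Amᵀ * S.P + S.P * S.Am = -Q) (hC : S.C.IsStable)
    (hkg : transferAt S.Am S.b S.c 0 ≠ 0) (hgain : S.GainRequirement)
    {xref : ℝ → Fin n → ℝ} {uref : ℝ → ℝ} (href : S.IsReferenceLoop xref uref) :
    ∃ κ : ℝ, ∀ Γc, 0 < Γc → ∀ x xhat θhat u, S.IsAdaptiveLoop Γc x xhat θhat u →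
      ∀ t, 0 ≤ t → ‖x t - xref t‖ ≤ κ * √(Γc⁻¹) ∧ |u t - uref t| ≤ κ * √(Γc⁻¹) := by
  obtain ⟨μ, hμ, hμP⟩ := exists_mul_norm_sq_le fun z hz => hAm.lyapunov_pos hQ hP hz
  obtain ⟨κ₁, hκ₁, hd⟩ := exists_abs_response_le_of_state S.C hC S.Am (S.b_ne_zero hkg)
  obtain ⟨κ₂, hκ₂, he⟩ := S.exists_norm_error_le hΩ_compact hθ hAm hgain
  obtain ⟨κ₃, hκ₃, hw⟩ := S.C.exists_abs_response_le hC
  set D := (S.θhat₀ - S.θ) ⬝ᵥ (S.θhat₀ - S.θ) with hD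
  have hD0 : 0 ≤ D := Finset.sum_nonneg fun i _ => mul_self_nonneg _
  set kK := ∑ i, |S.K i|
  set kθ := ∑ i, |S.θ i|
  have hkK : 0 ≤ kK := Finset.sum_nonneg fun i _ => abs_nonneg _
  have hkθ : 0 ≤ kθ := Finset.sum_nonneg fun i _ => abs_nonneg _
  -- `κ₂ κ₁` bounds `e`, the bracket bounds the three parts of `u - uref`, and `√(D / μ)` comes from
  -- the Lyapunov estimate; their sum serves both claims.
  refine ⟨(κ₂ * κ₁ + (kK * (κ₂ * κ₁) + κ₃ * (kθ * (κ₂ * κ₁)) + κ₁)) * √(D / μ), ?_⟩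
  intro Γc hΓ x xhat θhat u hloop t ht
  set X := √(D / μ) * √(Γc⁻¹) with hX
  have hX0 : 0 ≤ X := by positivity
  set η : ℝ → ℝ := fun τ => (θhat τ - S.θ) ⬝ᵥ x τ with hη
  have hηc : ContinuousOn η (Ici 0) := hloop.continuousOn_mismatch
  have hzX : ∀ τ, 0 ≤ τ → ‖xhat τ - x τ‖ ≤ X := by
    intro τ hτ
    have h1 := hloop.lyapunov_le hΓ hΩ_compact.isClosed hΩ_convex hθ hQ hP
      (hAm.lyapunov_isSymm hQ hP) hτ
    have h2 := (mul_le_mul_of_nonneg_left (hμP (xhat τ - x τ)) hΓ.le).trans h1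
    rw [hX, ← Real.sqrt_mul (by positivity)]
    refine Real.le_sqrt_of_sq_le ?_
    rw [← div_eq_mul_inv, div_div, le_div_iff₀ (by positivity)]
    linarith
  have hresp : ∀ τ, 0 ≤ τ → |S.C.response η τ| ≤ κ₁ * X := fun τ hτ =>
    hd _ η hηc hloop.prediction_error_zero
      (fun s hs => hloop.hasDerivWithinAt_prediction_error hs) X τ hτ fun s hs _ => hzX s hs
  set e : ℝ → Fin n → ℝ := fun τ => x τ - xref τ with hedef
  have hxc := hloop.plant.continuousOn
  have hrc := href.plant.continuousOn
  have hec : ContinuousOn e (Ici 0) := hxc.sub hrc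
  have hwc : ContinuousOn (fun τ => S.θ ⬝ᵥ e τ) (Ici 0) :=
    ContinuousOn.dotProduct_fun continuousOn_const hec
  -- Linearity of `C` applied to `θhatᵀ x = θᵀ xref + θᵀ e + η`.
  have hsplit : ∀ τ, 0 ≤ τ →
      S.C.response (fun s => θhat s ⬝ᵥ x s + S.kg * S.r s) τ =
        S.C.response (fun s => S.kg * S.r s + S.θ ⬝ᵥ xref s) τ +
          (S.C.response (fun s => S.θ ⬝ᵥ e s) τ + S.C.response η τ) := by
    intro τ hτ
    rw [← S.C.response_add hwc hηc hτ, ← S.C.response_add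
      (v := fun s => S.kg * S.r s + S.θ ⬝ᵥ xref s) (w := fun s => S.θ ⬝ᵥ e s + η s)
      ((continuousOn_const.mul hr).add (ContinuousOn.dotProduct_fun continuousOn_const hrc))
      (hwc.add hηc) hτ]
    congr 1
    ext s
    simp only [hη, hedef, dotProduct_sub, sub_dotProduct]
    ring
  have hu : ∀ τ, 0 ≤ τ → u τ - uref τ = -(S.K ⬝ᵥ e τ) +
      S.C.response (fun s => S.θ ⬝ᵥ e s) τ + S.C.response η τ := by
    intro τ hτ
    rw [hloop.control τ hτ, href.control τ hτ, hsplit τ hτ]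
    simp only [hedef, dotProduct_sub]
    ring
  have hed : ∀ τ, 0 ≤ τ → HasDerivWithinAt e (S.Am *ᵥ e τ +
      (S.C.response (fun s => S.θ ⬝ᵥ e s) τ - S.θ ⬝ᵥ e τ + S.C.response η τ) • S.b)
      (Ici 0) τ := by
    intro τ hτ
    refine ((hloop.plant.2 τ hτ).sub (href.plant.2 τ hτ)).congr_deriv ?_
    have hu' : u τ = uref τ + (-(S.K ⬝ᵥ e τ) +
      S.C.response (fun s => S.θ ⬝ᵥ e s) τ + S.C.response η τ) := by rw [← hu τ hτ]; ring
    rw [hu', S.mulVec_Am (e τ)]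
    simp only [hedef, dotProduct_sub, Matrix.mulVec_sub]
    module
  have heX : ∀ τ, 0 ≤ τ → ‖e τ‖ ≤ κ₂ * (κ₁ * X) := fun τ hτ =>
    he e (S.C.response η) (S.C.continuousOn_response hηc)
      (by simp only [hedef]; rw [hloop.plant.1, href.plant.1, sub_self]) hed (κ₁ * X) τ hτ
      fun s hs _ => hresp s hs
  have hwX : |S.C.response (fun s => S.θ ⬝ᵥ e s) t| ≤ κ₃ * (kθ * (κ₂ * (κ₁ * X))) :=
    hw _ _ t ht fun s hs _ => (abs_dotProduct_le _ _).trans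
      (mul_le_mul_of_nonneg_left (heX s hs) hkθ)
  have hKX : |S.K ⬝ᵥ e t| ≤ kK * (κ₂ * (κ₁ * X)) :=
    (abs_dotProduct_le _ _).trans (mul_le_mul_of_nonneg_left (heX t ht) hkK)
  have hsum : 0 ≤ kK * (κ₂ * (κ₁ * X)) + κ₃ * (kθ * (κ₂ * (κ₁ * X))) + κ₁ * X := by positivity
  have hκX : (κ₂ * κ₁ + (kK * (κ₂ * κ₁) + κ₃ * (kθ * (κ₂ * κ₁)) + κ₁)) * √(D / μ) * √(Γc⁻¹) =
      κ₂ * (κ₁ * X) + (kK * (κ₂ * (κ₁ * X)) + κ₃ * (kθ * (κ₂ * (κ₁ * X))) + κ₁ * X) := by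
    rw [hX]; ring
  rw [hκX]
  have hE : 0 ≤ κ₂ * (κ₁ * X) := by positivity
  constructor
  · linarith [heX t ht]
  · rw [hu t ht]
    have h3 := abs_add_three (-(S.K ⬝ᵥ e t)) (S.C.response (fun s => S.θ ⬝ᵥ e s) t)
      (S.C.response η t)
    rw [abs_neg] at h3
    linarith [hresp t ht]

end Data

/-! ### Uniform limits as the adaptation gain grows. -/

theorem tendstoUniformlyOn_zero_of_norm_le {E : Type*} [NormedAddCommGroup E]
    {F : ℝ → ℝ → E} {κ : ℝ}
    (h : ∀ Γ, 0 < Γ → ∀ t, 0 ≤ t → ‖F Γ t‖ ≤ κ * √(Γ⁻¹)) :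
    TendstoUniformlyOn F (fun _ => 0) atTop (Ici 0) := by
  have hlim : Tendsto (fun Γ : ℝ => κ * √(Γ⁻¹)) atTop (𝓝 0) := by
    have h1 := (Real.continuous_sqrt.tendsto 0).comp (tendsto_inv_atTop_zero (𝕜 := ℝ))
    rw [Real.sqrt_zero] at h1
    simpa using h1.const_mul κ
  rw [Metric.tendstoUniformlyOn_iff]
  intro ε hε
  filter_upwards [hlim.eventually_lt_const hε, eventually_gt_atTop 0] with Γ h1 h2 t ht
  rw [dist_zero_left]
  exact (h Γ h2 t ht).trans_lt h1

end L1Adaptive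

theorem corollary1 {n : ℕ} (S : L1Adaptive.Data n) (Q : Matrix (Fin n) (Fin n) ℝ)
    -- the plant
    (hctrl : L1Adaptive.IsControllable S.A S.b)
    (hΩ_compact : IsCompact S.Ω) (hΩ_convex : Convex ℝ S.Ω) (hθ : S.θ ∈ S.Ω)
    -- the reference signal is bounded and continuous
    (hr_cont : ContinuousOn S.r (Ici 0)) (hr_bdd : ∃ M : ℝ, ∀ t, 0 ≤ t → |S.r t| ≤ M)
    -- the controller
    (hAm : L1Adaptive.IsHurwitz S.Am)
    (hQ : Q.PosDef) (hP : S.Amᵀ * S.P + S.P * S.Am = -Q)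
    (hC_stable : S.C.IsStable) (hC_dc : S.C.transfer 0 = 1)
    (hkg : L1Adaptive.transferAt S.Am S.b S.c 0 ≠ 0)
    (hθhat₀ : S.θhat₀ ∈ S.Ω)
    (hgain : S.GainRequirement)
    -- the reference system
    (xref : ℝ → Fin n → ℝ) (uref : ℝ → ℝ) (href : S.IsReferenceLoop xref uref)
    -- the closed-loop signals for each adaptation gain
    (x xhat θhat : ℝ → ℝ → Fin n → ℝ) (u : ℝ → ℝ → ℝ)
    (hloop : ∀ Γc, 0 < Γc → S.IsAdaptiveLoop Γc (x Γc) (xhat Γc) (θhat Γc) (u Γc)) :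
    (∀ t, 0 ≤ t →
      Tendsto (fun Γc => x Γc t - xref t) atTop (𝓝 0) ∧
      Tendsto (fun Γc => S.c ⬝ᵥ x Γc t - S.c ⬝ᵥ xref t) atTop (𝓝 0) ∧
      Tendsto (fun Γc => u Γc t - uref t) atTop (𝓝 0)) ∧
    TendstoUniformlyOn (fun Γc t => x Γc t - xref t) (fun _ => 0) atTop (Ici 0) ∧
    TendstoUniformlyOn (fun Γc t => S.c ⬝ᵥ x Γc t - S.c ⬝ᵥ xref t) (fun _ => 0) atTop (Ici 0) ∧
    TendstoUniformlyOn (fun Γc t => u Γc t - uref t) (fun _ => 0) atTop (Ici 0) := by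

  obtain ⟨κ, hκ⟩ := L1Adaptive.Data.exists_tracking_bound hΩ_compact hΩ_convex hθ hr_cont hAm hQ hP
    hC_stable hkg hgain href
  have hx : TendstoUniformlyOn (fun Γc t => x Γc t - xref t) (fun _ => 0) atTop (Ici 0) :=
    L1Adaptive.tendstoUniformlyOn_zero_of_norm_le fun Γ hΓ t ht =>
      (hκ Γ hΓ _ _ _ _ (hloop Γ hΓ) t ht).1
  have hu : TendstoUniformlyOn (fun Γc t => u Γc t - uref t) (fun _ => 0) atTop (Ici 0) :=
    L1Adaptive.tendstoUniformlyOn_zero_of_norm_le fun Γ hΓ t ht =>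
      (hκ Γ hΓ _ _ _ _ (hloop Γ hΓ) t ht).2
  have hy : TendstoUniformlyOn (fun Γc t => S.c ⬝ᵥ x Γc t - S.c ⬝ᵥ xref t) (fun _ => 0) atTop
      (Ici 0) := by
    refine L1Adaptive.tendstoUniformlyOn_zero_of_norm_le (κ := (∑ i, |S.c i|) * κ)
      fun Γ hΓ t ht => ?_
    rw [← dotProduct_sub, Real.norm_eq_abs, mul_assoc]
    exact (L1Adaptive.abs_dotProduct_le _ _).trans (mul_le_mul_of_nonneg_left
      (hκ Γ hΓ _ _ _ _ (hloop Γ hΓ) t ht).1 (Finset.sum_nonneg fun i _ => abs_nonneg _))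
  exact ⟨fun t ht => ⟨hx.tendsto_at ht, hy.tendsto_at ht, hu.tendsto_at ht⟩, hx, hy, hu⟩
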